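/- Let $m,n\ge 1$, let $A$ be an $m\times n$ matrix over $\mathbb{Z}_2$ and $b\in\mathbb{Z}_2^m$; put $V_i=\{j : A_{ij}\ne 0\}$. The linear system game $\mathcal{G}$ of $Ax=b$ is the following two-player non-local game: Alice receives $i\in\{1,\dots,m\}$ and Bob receives $j\in\{1,\dots,n\}$, uniformly at random; Alice must reply with $y\in\mathbb{Z}_2^{V_i}$ satisfying $\sum_{k\in V_i}y_k=b_i$ (any other answer loses), Bob replies with $x_j\in\mathbb{Z}_2$, and they win if $j\notin V_i$ or $y_j=x_j$. The quantum value $\omega^q(\mathcal{G})$ is the supremum of the winning probabilities $$\frac1{mn}\sum_{i,j}\ \sum_{(y,z)\text{ winning on }(i,j)}\langle\psi|A_i^y\otimes B_j^z|\psi\rangle$$ over all Hilbert spaces $H_A,H_B$, at least one of which is finite-dimensional, all unit vectors $|\psi\rangle\in H_A\otimes H_B$, and all POVMs $\{A_i^y\}_y$ on $H_A$ and $\{B_j^z\}_z$ on $H_B$. The solution group $\Gamma(A,b)$ is the group with generators $x_1,\dots,x_n,J$ and relations $J^2=e$, $[x_j,J]=e$ and $x_j^2=e$ for all $j$, $\prod_{j\in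 V_i}x_j=J^{b_i}$ for all $i$ (product taken in increasing order of $j$), and $x_jx_{j'}=x_{j'}x_j$ for all $i$ and all $j,j'\in V_i$. For a presented group $G=\langle S:R\rangle$, an $\epsilon$-representation is a homomorphism $\phi$ from the free group $\mathcal{F}(S)$ to the unitary group of some $\mathbb{C}^d$, $d\geq 1$, with $\|\phi(r)-1\|_f\le\epsilon$ for all $r\in R$, where $\|M\|_f=\sqrt{\mathrm{Tr}(M^*M)/d}$. An element $g\in G$ is non-trivial in approximate representations if there are a representative $w\in\mathcal{F}(S)$ of $g$ and $\delta>0$ such that for every $\epsilon>0$ there is an $\epsilon$-representation $\phi$ with $\|\phi(w)-1\|_f\ge\delta$. Then $\omega^q(\mathcal{G})=1$ if and only if $J$ is non-trivial in approximate representations of $\Gamma(A,b)$. -/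

import Mathlib

open scoped TensorProduct Matrix

/-! ### Non-local games and their quantum value -/

/-- A two-player non-local game: finite sets of questions `X`, `Y`, finite sets of answers
`A x`, `B y` (allowed to depend on the question), a probability distribution `π` on pairs of
questions and a winning predicate `V`. -/
structure NonlocalGame where
  X : Type
  Y : Type
  A : X → Type
  B : Y → Type
  [fintypeX : Fintype X]
  [fintypeY : Fintype Y]
  [fintypeA : ∀ x, Fintype (A x)]
  [fintypeB : ∀ y, Fintype (B y)]
  π : X → Y → ℝ
  π_nonneg : ∀ x y, 0 ≤ π x y
  π_sum : ∑ x, ∑ y, π x y = 1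
  V : (x : X) → (y : Y) → A x → B y → Prop

namespace NonlocalGame

attribute [instance] fintypeX fintypeY fintypeA fintypeB

end NonlocalGame

/-- A positive operator-valued measure with finite outcome set `O` on the Hilbert space `H`. -/
structure IsPOVM {O : Type} [Fintype O] {H : Type} [NormedAddCommGroup H]
    [InnerProductSpace ℂ H] [CompleteSpace H] (M : O → (H →L[ℂ] H)) : Prop where
  isPositive : ∀ o, (M o).IsPositive
  sum_eq_one : ∑ o, M o = 1

/-- A finite-dimensional quantum strategy for `G`: Hilbert spaces `HA` and `HB`, at least one of
which is finite-dimensional, a unit vector `ψ` in `HA ⊗ HB`, and a POVM on `HA` (resp. `HB`) for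
every question of Alice (resp. Bob). Since one of the two factors is finite-dimensional, the
algebraic tensor product is already complete, so it is the Hilbert space tensor product. -/
structure FinDimStrategy (G : NonlocalGame) where
  HA : Type
  HB : Type
  [normedHA : NormedAddCommGroup HA]
  [innerHA : InnerProductSpace ℂ HA]
  [completeHA : CompleteSpace HA]
  [normedHB : NormedAddCommGroup HB]
  [innerHB : InnerProductSpace ℂ HB]
  [completeHB : CompleteSpace HB]
  finite : FiniteDimensional ℂ HA ∨ FiniteDimensional ℂ HB
  ψ : HA ⊗[ℂ] HB
  norm_ψ : ‖ψ‖ = 1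
  MA : (x : G.X) → G.A x → (HA →L[ℂ] HA)
  MB : (y : G.Y) → G.B y → (HB →L[ℂ] HB)
  povmA : ∀ x, IsPOVM (MA x)
  povmB : ∀ y, IsPOVM (MB y)

namespace FinDimStrategy

attribute [instance] normedHA innerHA completeHA normedHB innerHB completeHB

/-- The probability `⟨ψ| A_x^a ⊗ B_y^b |ψ⟩` of the answers `a, b` on the questions `x, y`. -/
noncomputable def prob {G : NonlocalGame} (S : FinDimStrategy G)
    (x : G.X) (y : G.Y) (a : G.A x) (b : G.B y) : ℝ :=
  (inner ℂ S.ψ (TensorProduct.map (S.MA x a).toLinearMap (S.MB y b).toLinearMap S.ψ)).re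

open Classical in
/-- The winning probability `ω(G; S)`. -/
noncomputable def winProb {G : NonlocalGame} (S : FinDimStrategy G) : ℝ :=
  ∑ x, ∑ y, G.π x y * ∑ a, ∑ b, (if G.V x y a b then 1 else 0) * S.prob x y a b

end FinDimStrategy

/-- The quantum value `ω^q(G)`: the supremum of the winning probabilities of all
finite-dimensional quantum strategies. -/
noncomputable def quantumValue (G : NonlocalGame) : ℝ :=
  ⨆ S : FinDimStrategy G, S.winProb

/-! ### Linear system games -/

/-- The set `V_i` of indices of the variables which appear in equation `i`. -/
def eqnVars {m n : ℕ} (A : Matrix (Fin m) (Fin n) (ZMod 2)) (i : Fin m) : Finset (Fin n) :=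
  Finset.univ.filter fun j => A i j ≠ 0

/-- The linear system game of `Ax = b`. Alice is given an equation `i`, Bob is given a variable
`j`, both uniformly at random. Alice has to answer with a vector `y ∈ ℤ₂^{V_i}` which satisfies
equation `i` (any other answer loses), Bob answers with a value `z ∈ ℤ₂`, and they win if
`j ∉ V_i` or `y_j = z`. -/
noncomputable def linearSystemGame {m n : ℕ} [NeZero m] [NeZero n]
    (A : Matrix (Fin m) (Fin n) (ZMod 2)) (b : Fin m → ZMod 2) : NonlocalGame where
  X := Fin m
  Y := Fin n
  A := fun i => {j // j ∈ eqnVars A i} → ZMod 2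
  B := fun _ => ZMod 2
  π := fun _ _ => 1 / ((m : ℝ) * (n : ℝ))
  π_nonneg := fun _ _ => by positivity
  π_sum := by
    have hm : (m : ℝ) ≠ 0 := Nat.cast_ne_zero.2 (NeZero.ne m)
    have hn : (n : ℝ) ≠ 0 := Nat.cast_ne_zero.2 (NeZero.ne n)
    simp only [Finset.sum_const, Finset.card_univ, Fintype.card_fin, nsmul_eq_mul]
    field_simp
  V := fun i j y z => ∑ k, y k = b i ∧ ∀ h : j ∈ eqnVars A i, y ⟨j, h⟩ = z

/-! ### Approximate representations -/

/-- The normalized Frobenius norm `‖M‖_f = √(Tr(M* M)) / √d` on `d × d` matrices. -/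
noncomputable def normalizedFrobenius {d : ℕ} (M : Matrix (Fin d) (Fin d) ℂ) : ℝ :=
  Real.sqrt (Mᴴ * M).trace.re / Real.sqrt d

/-- `φ` is an `ε`-representation of the group `⟨S : R⟩`. -/
def IsApproxRep {S : Type} (R : Set (FreeGroup S)) (ε : ℝ) {d : ℕ}
    (φ : FreeGroup S →* Matrix.unitaryGroup (Fin d) ℂ) : Prop :=
  ∀ r ∈ R, normalizedFrobenius ((φ r : Matrix (Fin d) (Fin d) ℂ) - 1) ≤ ε

/-- The element `g` of `⟨S : R⟩` is non-trivial in approximate representations. -/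
def NontrivialInApproxReps {S : Type} (R : Set (FreeGroup S)) (g : PresentedGroup R) : Prop :=
  ∃ w : FreeGroup S, PresentedGroup.mk R w = g ∧ ∃ δ : ℝ, 0 < δ ∧ ∀ ε : ℝ, 0 < ε →
    ∃ d : ℕ, 0 < d ∧ ∃ φ : FreeGroup S →* Matrix.unitaryGroup (Fin d) ℂ,
      IsApproxRep R ε φ ∧ δ ≤ normalizedFrobenius ((φ w : Matrix (Fin d) (Fin d) ℂ) - 1)

/-! ### The solution group -/

namespace SolutionGroup

/-- The generator `x_j` of the free group on `x_1, …, x_n, J`. -/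
def x {n : ℕ} (j : Fin n) : FreeGroup (Option (Fin n)) := FreeGroup.of (some j)

/-- The generator `J` of the free group on `x_1, …, x_n, J`. -/
def J {n : ℕ} : FreeGroup (Option (Fin n)) := FreeGroup.of none

/-- The product of the `x_j`, `j ∈ V_i`, in increasing order of `j`. -/
def eqnProd {m n : ℕ} (A : Matrix (Fin m) (Fin n) (ZMod 2)) (i : Fin m) :
    FreeGroup (Option (Fin n)) :=
  (((eqnVars A i).sort (· ≤ ·)).map x).prod

/-- The defining relators of the solution group of `Ax = b`. -/
inductive IsRelator {m n : ℕ} (A : Matrix (Fin m) (Fin n) (ZMod 2)) (b : Fin m → ZMod 2) :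
    FreeGroup (Option (Fin n)) → Prop
  | J_sq : IsRelator A b (J ^ 2)
  | x_comm_J (j : Fin n) : IsRelator A b (x j * J * (x j)⁻¹ * J⁻¹)
  | x_sq (j : Fin n) : IsRelator A b (x j ^ 2)
  | eqn (i : Fin m) : IsRelator A b (eqnProd A i * (J ^ (b i).val)⁻¹)
  | x_comm_x (i : Fin m) (j j' : Fin n) (hj : j ∈ eqnVars A i) (hj' : j' ∈ eqnVars A i) :
      IsRelator A b (x j * x j' * (x j)⁻¹ * (x j')⁻¹)

/-- The set of defining relators of the solution group of `Ax = b`. -/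
def relators {m n : ℕ} (A : Matrix (Fin m) (Fin n) (ZMod 2)) (b : Fin m → ZMod 2) :
    Set (FreeGroup (Option (Fin n))) := {r | IsRelator A b r}

end SolutionGroup

/-- The solution group `Γ(A, b)` of `Ax = b`. -/
abbrev SolutionGroup {m n : ℕ} (A : Matrix (Fin m) (Fin n) (ZMod 2)) (b : Fin m → ZMod 2) :
    Type :=
  PresentedGroup (SolutionGroup.relators A b)

/-- The generator `J` of the solution group `Γ(A, b)`. -/
def SolutionGroup.genJ {m n : ℕ} (A : Matrix (Fin m) (Fin n) (ZMod 2)) (b : Fin m → ZMod 2) :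
    SolutionGroup A b :=
  PresentedGroup.of none

open scoped ComplexOrder

/-! From representations to strategies. Given an approximate representation φ, take `Q = (1 -
φ(J))/2`, normalised, as the shared state. Alice measures the variables of her equation one after
the other with Kraus operators `(1 ± φ(x_j))/2`, and Bob measures his variable in the same way.
These give exact POVMs because φ is unitary, even when `φ(x_j)` is not an involution. A pair of
answers has probability `‖K Q E‖² / ‖Q‖²`, where `K Q E` is the image of a fixed element of the
group algebra of the free group (`exists_strategy_of_rep`). For losing answers that element dies in
`ℂ[Γ]` (`amplitude_solutionGen_eq_zero`), and whatever dies there becomes small in normalised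
Frobenius norm along ε-representations with ε → 0 (`isAsymptoticallyNull_of_map_eq_zero`). The
denominator stays bounded below because `J` is non-trivial.

From strategies to representations. A Schmidt decomposition gives probabilities `Tr(D A D B)` with
`D = diag(c)` and `∑ c² = 1`. In a nearly perfect strategy Bob's observables are hermitian
contractions which almost satisfy the relations with `J = -1`, measured by `‖· D‖`
(`IsNearPerfect.norm_word_sub_le`). Consistency with Alice makes them almost commute with `D²`
(`IsNearPerfect.sum_commutator_le`). It remains to replace the weight `D²` by a uniform one. As `D²`
is the integral over `u ≥ 0` of the projections onto `{t : c t ² > u}`, the total error is an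
average over thresholds, so some threshold has small error relative to its rank
(`exists_threshold_set`). Compressing to the range of that projection and taking signs gives genuine
involutions (`exists_involution_intertwining`, `exists_isometry_involutions`). Together with `J ↦
-1` they form the approximate representation. -/

open scoped MatrixOrder Matrix.Norms.L2Operator in
theorem Matrix.PosSemidef.exists_eq_conjTranspose_mul_self {p : Type*} [Fintype p] [DecidableEq p]
    {M : Matrix p p ℂ} (hM : M.PosSemidef) : ∃ R : Matrix p p ℂ, M = Rᴴ * R :=
  CStarAlgebra.nonneg_iff_eq_star_mul_self.1 hM.nonneg

attribute [local instance] Matrix.frobeniusNormedAddCommGroup Matrix.frobeniusNormedSpace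

/-! ### The Frobenius norm. -/

section Frobenius

variable {p q r : Type*} [Fintype p] [Fintype q] [Fintype r]

theorem frobenius_sq_eq_sum (M : Matrix p q ℂ) : ‖M‖ ^ 2 = ∑ i, ∑ j, ‖M i j‖ ^ 2 := by
  rw [Matrix.frobenius_norm_def, ← Real.sqrt_eq_rpow, Real.sq_sqrt (by positivity)]
  simp

theorem frobenius_sq_eq_trace (M : Matrix p q ℂ) : ‖M‖ ^ 2 = (Mᴴ * M).trace.re := by
  rw [frobenius_sq_eq_sum, Finset.sum_comm]
  simp only [Matrix.trace, Matrix.diag, Matrix.mul_apply, Matrix.conjTranspose_apply,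
    Complex.re_sum]
  refine Finset.sum_congr rfl fun i _ => Finset.sum_congr rfl fun j _ => ?_
  rw [Complex.star_def, ← Complex.normSq_eq_conj_mul_self, Complex.ofReal_re, Complex.normSq_eq_norm_sq]

theorem normalizedFrobenius_eq {d : ℕ} (M : Matrix (Fin d) (Fin d) ℂ) :
    normalizedFrobenius M = ‖M‖ / Real.sqrt d := by
  rw [normalizedFrobenius, ← frobenius_sq_eq_trace, Real.sqrt_sq (norm_nonneg _)]

theorem frobenius_isometry_mul [DecidableEq q] {U : Matrix p q ℂ} (hU : Uᴴ * U = 1)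
    (M : Matrix q r ℂ) : ‖U * M‖ = ‖M‖ := by
  rw [← sq_eq_sq₀ (norm_nonneg _) (norm_nonneg _), frobenius_sq_eq_trace, frobenius_sq_eq_trace,
    Matrix.conjTranspose_mul, Matrix.mul_assoc, ← Matrix.mul_assoc Uᴴ, hU, Matrix.one_mul]

theorem frobenius_mul_coisometry [DecidableEq q] {U : Matrix q r ℂ} (hU : U * Uᴴ = 1)
    (M : Matrix p q ℂ) : ‖M * U‖ = ‖M‖ := by
  rw [← Matrix.frobenius_norm_conjTranspose, Matrix.conjTranspose_mul,
    frobenius_isometry_mul (by simpa using hU), Matrix.frobenius_norm_conjTranspose]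

theorem Matrix.PosSemidef.trace_re_nonneg {M : Matrix p p ℂ} (hM : M.PosSemidef) :
    0 ≤ M.trace.re :=
  (Complex.nonneg_iff.1 hM.trace_nonneg).1

theorem frobenius_contraction_mul [DecidableEq p] {B : Matrix p p ℂ}
    (hB : (1 - Bᴴ * B).PosSemidef) (M : Matrix p q ℂ) : ‖B * M‖ ≤ ‖M‖ := by
  rw [← sq_le_sq₀ (norm_nonneg _) (norm_nonneg _), frobenius_sq_eq_trace, frobenius_sq_eq_trace]
  have h := (hB.conjTranspose_mul_mul_same M).trace_re_nonneg
  have e : Mᴴ * (1 - Bᴴ * B) * M = Mᴴ * M - (B * M)ᴴ * (B * M) := by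
    simp only [Matrix.conjTranspose_mul, Matrix.mul_sub, Matrix.sub_mul, Matrix.mul_assoc,
      Matrix.one_mul]
  rw [e, Matrix.trace_sub, Complex.sub_re] at h
  linarith

theorem frobenius_sub_sq (M N : Matrix p q ℂ) :
    ‖M - N‖ ^ 2 = ‖M‖ ^ 2 + ‖N‖ ^ 2 - 2 * (Mᴴ * N).trace.re := by
  have h : (Nᴴ * M).trace.re = (Mᴴ * N).trace.re := by
    rw [← Matrix.conjTranspose_conjTranspose M, ← Matrix.conjTranspose_mul,
      Matrix.trace_conjTranspose, Matrix.conjTranspose_conjTranspose]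
    simp
  rw [frobenius_sq_eq_trace, frobenius_sq_eq_trace, frobenius_sq_eq_trace,
    Matrix.conjTranspose_sub, Matrix.sub_mul, Matrix.mul_sub, Matrix.mul_sub]
  simp only [Matrix.trace_sub, Complex.sub_re]
  linarith

end Frobenius

/-! ### Complementary positive matrices. -/

section PosSemidef

variable {p : Type*} [Fintype p] [DecidableEq p]

/-- The two matrices commute, so `P Q = P Q (P + Q)` is the sum of the congruences `P Q P` and `Q P
Q`. -/
theorem Matrix.PosSemidef.mul_of_add_eq_one {P Q : Matrix p p ℂ} (hP : P.PosSemidef)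
    (hQ : Q.PosSemidef) (h : P + Q = 1) : (P * Q).PosSemidef := by
  have hc : P * Q = Q * P := by
    rw [eq_sub_of_add_eq h]; noncomm_ring
  have e : P * Q = P * Q * P + Q * P * Q := by
    calc P * Q = P * Q * (P + Q) := by rw [h, mul_one]
      _ = P * Q * P + P * Q * Q := mul_add _ _ _
      _ = _ := by rw [hc]
  rw [e]
  refine .add ?_ ?_
  · have := hQ.conjTranspose_mul_mul_same P
    rwa [hP.isHermitian.eq] at this
  · have := hP.conjTranspose_mul_mul_same Q
    rwa [hQ.isHermitian.eq] at this

theorem one_sub_sq_of_add_eq_one {P Q : Matrix p p ℂ} (h : P + Q = 1) :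
    1 - (P - Q) * (P - Q) = (4 : ℂ) • (P * Q) := by
  rw [eq_sub_of_add_eq h, ofNat_smul_eq_nsmul]; noncomm_ring

theorem Matrix.PosSemidef.one_sub_sq {P Q : Matrix p p ℂ} (hP : P.PosSemidef)
    (hQ : Q.PosSemidef) (h : P + Q = 1) : (1 - (P - Q)ᴴ * (P - Q)).PosSemidef := by
  rw [(hP.isHermitian.sub hQ.isHermitian).eq, one_sub_sq_of_add_eq_one h]
  exact (hP.mul_of_add_eq_one hQ h).smul (by norm_num)

end PosSemidef

/-! ### Schmidt decomposition and compression of operators. -/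

section Schmidt

variable {H K : Type*} [NormedAddCommGroup H] [InnerProductSpace ℂ H]
  [NormedAddCommGroup K] [InnerProductSpace ℂ K]

theorem TensorProduct.exists_eq_sum_tmul_orthonormal (ψ : H ⊗[ℂ] K) :
    ∃ (k : ℕ) (a : Fin k → H) (g : Fin k → K), Orthonormal ℂ g ∧ ψ = ∑ i, a i ⊗ₜ[ℂ] g i := by
  obtain ⟨N, hN, hψ⟩ := TensorProduct.exists_finite_submodule_right_of_setFinite {ψ}
    (Set.finite_singleton ψ)
  obtain ⟨z, hz⟩ := hψ rfl
  let g := stdOrthonormalBasis ℂ N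
  have key : ∀ z : H ⊗[ℂ] N, ∃ a : Fin (Module.finrank ℂ N) → H, z = ∑ i, a i ⊗ₜ[ℂ] g i := by
    intro z
    induction z using TensorProduct.induction_on with
    | zero => exact ⟨0, by simp⟩
    | tmul x y =>
      refine ⟨fun i => g.repr y i • x, ?_⟩
      conv_lhs => rw [← g.sum_repr y, TensorProduct.tmul_sum]
      exact Finset.sum_congr rfl fun i _ => by rw [TensorProduct.tmul_smul, TensorProduct.smul_tmul']
    | add x y hx hy =>
      obtain ⟨a, rfl⟩ := hx
      obtain ⟨b, rfl⟩ := hy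
      exact ⟨a + b, by simp [TensorProduct.add_tmul, Finset.sum_add_distrib]⟩
  obtain ⟨a, rfl⟩ := key z
  refine ⟨_, a, fun i => g i, ?_, ?_⟩
  · exact g.orthonormal.comp_linearIsometry N.subtypeₗᵢ
  · rw [← hz, map_sum]
    rfl

/-- The Schmidt decomposition of a tensor. -/
theorem TensorProduct.exists_schmidt (ψ : H ⊗[ℂ] K) :
    ∃ (ι : Type) (_ : Fintype ι) (_ : DecidableEq ι) (c : ι → ℝ) (e : ι → H) (f : ι → K),
      (∀ i, 0 < c i) ∧ Orthonormal ℂ e ∧ Orthonormal ℂ f ∧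
        ψ = ∑ i, (c i : ℂ) • (e i ⊗ₜ[ℂ] f i) := by
  classical
  obtain ⟨k, a, g, hg, rfl⟩ := exists_eq_sum_tmul_orthonormal ψ
  have hG := Matrix.isHermitian_gram (𝕜 := ℂ) a
  set U : Matrix (Fin k) (Fin k) ℂ := (hG.eigenvectorUnitary : Matrix (Fin k) (Fin k) ℂ) with hU
  have hUU : U * Uᴴ = 1 := Unitary.mul_star_self_of_mem hG.eigenvectorUnitary.2
  have hUU' : Uᴴ * U = 1 := Unitary.star_mul_self_of_mem hG.eigenvectorUnitary.2
  have hdiag : Uᴴ * Matrix.gram ℂ a * U = Matrix.diagonal (fun i => (hG.eigenvalues i : ℂ)) := by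
    have := hG.conjStarAlgAut_star_eigenvectorUnitary
    rw [Unitary.conjStarAlgAut_apply] at this
    simpa [Matrix.star_eq_conjTranspose, Function.comp_def] using this
  -- Rotating the first family by `U` diagonalises its Gram matrix; rotating the second by the
  -- conjugate of `U` keeps it orthonormal and leaves the tensor unchanged.
  let a' : Fin k → H := fun s => ∑ i, U i s • a i
  let f : Fin k → K := fun s => ∑ i, star (U i s) • g i
  have ha' : ∀ s t, inner ℂ (a' s) (a' t) = if s = t then (hG.eigenvalues s : ℂ) else 0 := by
    intro s t
    have := congrFun (congrFun hdiag s) t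
    rw [Matrix.diagonal_apply] at this
    rw [← this]
    simp only [a', inner_sum, Matrix.mul_apply]
    refine Finset.sum_congr rfl fun i _ => ?_
    rw [sum_inner, Finset.sum_mul]
    refine Finset.sum_congr rfl fun j _ => ?_
    simp only [inner_smul_left, inner_smul_right, Matrix.gram_apply, Matrix.conjTranspose_apply,
      starRingEnd_apply]
    ring
  have hf : Orthonormal ℂ f := by
    rw [orthonormal_iff_ite]
    intro s t
    have := congrFun (congrFun hUU' t) s
    simp only [Matrix.mul_apply, Matrix.conjTranspose_apply, Matrix.one_apply] at this
    simp only [eq_comm (a := s)]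
    rw [← this]
    simp only [f, inner_sum]
    refine Finset.sum_congr rfl fun i _ => ?_
    rw [sum_inner]
    simp [inner_smul_left, inner_smul_right, orthonormal_iff_ite.1 hg]
  have hsum : ∑ i, a i ⊗ₜ[ℂ] g i = ∑ s, a' s ⊗ₜ[ℂ] f s := by
    have h : ∀ i j, ∑ s, U i s * star (U j s) = if i = j then 1 else 0 := by
      intro i j
      have := congrFun (congrFun hUU i) j
      simpa only [Matrix.mul_apply, Matrix.conjTranspose_apply, Matrix.one_apply] using this
    have h1 : ∀ s, a' s ⊗ₜ[ℂ] f s = ∑ i, ∑ j, (U i s * star (U j s)) • (a i ⊗ₜ[ℂ] g j) := by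
      intro s
      rw [TensorProduct.sum_tmul]
      refine Finset.sum_congr rfl fun i _ => ?_
      rw [TensorProduct.tmul_sum]
      refine Finset.sum_congr rfl fun j _ => ?_
      rw [TensorProduct.tmul_smul, ← TensorProduct.smul_tmul', smul_smul, mul_comm]
    simp only [h1]
    rw [Finset.sum_comm]
    refine Finset.sum_congr rfl fun i _ => ?_
    rw [Finset.sum_comm]
    simp only [← Finset.sum_smul, h]
    simp
  have hne : ∀ s : {s // a' s ≠ 0}, (‖a' s‖ : ℂ) ≠ 0 := fun s => by
    simpa using s.2
  -- Zero vectors are discarded, so that the Schmidt coefficients are strictly positive and the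
  -- remaining vectors can be normalised.
  refine ⟨{s // a' s ≠ 0}, inferInstance, inferInstance, fun s => ‖a' s‖,
    fun s => ((‖a' s‖ : ℂ)⁻¹) • a' s, fun s => f s, fun s => norm_pos_iff.2 s.2, ?_,
    hf.comp _ Subtype.val_injective, ?_⟩
  · refine ⟨fun s => ?_, fun s t hst => ?_⟩
    · rw [norm_smul, norm_inv, Complex.norm_real, norm_norm]
      exact inv_mul_cancel₀ (norm_ne_zero_iff.2 s.2)
    · have : (s : Fin k) ≠ t := fun h => hst (Subtype.ext h)
      simp [inner_smul_left, inner_smul_right, ha', this]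
  · have h2 : ∀ s : {s // a' s ≠ 0}, (‖a' s‖ : ℂ) • (((‖a' s‖ : ℂ)⁻¹ • a' s) ⊗ₜ[ℂ] f s) =
        a' s ⊗ₜ[ℂ] f s := fun s => by
      rw [TensorProduct.smul_tmul', smul_smul, mul_inv_cancel₀ (hne s), one_smul]
    rw [hsum, Finset.sum_congr rfl fun s _ => h2 s,
      ← Finset.sum_subtype (Finset.univ.filter (a' · ≠ 0)) (by simp)
        (fun s => a' s ⊗ₜ[ℂ] f s)]
    refine (Finset.sum_filter_of_ne (p := (a' · ≠ 0)) fun s _ hs h0 => hs ?_).symm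
    rw [h0, TensorProduct.zero_tmul]

theorem ContinuousLinearMap.IsPositive.posSemidef_compression {ι : Type*} [Fintype ι]
    {M : H →L[ℂ] H} (hM : M.IsPositive) (e : ι → H) :
    (Matrix.of fun s t => inner ℂ (e s) (M (e t))).PosSemidef := by
  rw [Matrix.posSemidef_iff_dotProduct_mulVec]
  refine ⟨?_, fun x => ?_⟩
  · ext s t
    rw [Matrix.conjTranspose_apply, Matrix.of_apply, Matrix.of_apply, ← starRingEnd_apply,
      inner_conj_symm]
    exact hM.isSymmetric _ _
  · have := hM.inner_nonneg_right (∑ s, x s • e s)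
    convert this using 1
    simp only [dotProduct, Matrix.mulVec, map_sum, map_smul, sum_inner, inner_sum, inner_smul_left,
      inner_smul_right, Matrix.of_apply, Pi.star_apply, Finset.mul_sum, starRingEnd_apply]
    rw [Finset.sum_comm]
    refine Finset.sum_congr rfl fun i _ => Finset.sum_congr rfl fun j _ => by ring

/-- A tensor with coefficient matrix `Q` is treated as `Q` itself: the left factor acts by left
multiplication, the right factor by right multiplication with the transpose. Only compressions to
`e` and `f` enter, so orthonormality plays no role. -/
theorem inner_map_sum_tmul {ι : Type*} [Fintype ι] (M : H →L[ℂ] H) (N : K →L[ℂ] K)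
    (Q : Matrix ι ι ℂ) (e : ι → H) (f : ι → K) :
    inner ℂ (∑ s, ∑ t, Q s t • (e s ⊗ₜ[ℂ] f t))
      (TensorProduct.map M.toLinearMap N.toLinearMap (∑ s, ∑ t, Q s t • (e s ⊗ₜ[ℂ] f t))) =
    ((Qᴴ * Matrix.of (fun s t => inner ℂ (e s) (M (e t))) * Q *
      (Matrix.of fun s t => inner ℂ (f s) (N (f t)))ᵀ).trace) := by
  have hin : ∀ (a b : ℂ) (x x' : H) (y y' : K), @inner ℂ (H ⊗[ℂ] K) InnerProductSpace.toInner
      (a • (x ⊗ₜ[ℂ] y)) (b • (x' ⊗ₜ[ℂ] y')) = star a * b * inner ℂ x x' * inner ℂ y y' := by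
    intro a b x x' y y'
    rw [TensorProduct.smul_tmul', TensorProduct.smul_tmul']
    refine (TensorProduct.inner_tmul ℂ _ _ _ _).trans ?_
    rw [inner_smul_left, inner_smul_right, starRingEnd_apply]
    ring
  change @inner ℂ (H ⊗[ℂ] K) InnerProductSpace.toInner _ _ = _
  simp only [map_sum, map_smul, TensorProduct.map_tmul, sum_inner]
  simp only [inner_sum, Finset.sum_mul, Matrix.trace, Matrix.diag,
    Matrix.mul_apply, Matrix.of_apply, Matrix.transpose_apply, Matrix.conjTranspose_apply,
    hin, ContinuousLinearMap.coe_coe]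
  rw [Finset.sum_comm]
  refine Finset.sum_congr rfl fun i _ => ?_
  rw [Finset.sum_comm]
  conv_lhs => enter [2, x]; rw [Finset.sum_comm]
  rw [Finset.sum_comm]
  refine Finset.sum_congr rfl fun j _ => ?_
  refine Finset.sum_congr rfl fun k _ => Finset.sum_congr rfl fun l _ => ?_
  ring

end Schmidt

/-! ### Strategies in matrix form. -/

section Strategies

/-- The state is a finite sum of elementary tensors, so compressing both sides to its Schmidt
vectors changes no probability, even if one of the spaces is infinite-dimensional. -/
theorem FinDimStrategy.exists_matrices {G : NonlocalGame} (S : FinDimStrategy G) :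
    ∃ (ι : Type) (_ : Fintype ι) (_ : DecidableEq ι) (c : ι → ℝ)
      (A : (x : G.X) → G.A x → Matrix ι ι ℂ) (B : (y : G.Y) → G.B y → Matrix ι ι ℂ),
      (∀ i, 0 < c i) ∧ ∑ i, c i ^ 2 = 1 ∧
      (∀ x a, (A x a).PosSemidef) ∧ (∀ x, ∑ a, A x a = 1) ∧
      (∀ y b, (B y b).PosSemidef) ∧ (∀ y, ∑ b, B y b = 1) ∧
      ∀ x y a b, S.prob x y a b = (Matrix.diagonal (fun i => (c i : ℂ)) * A x a *
        Matrix.diagonal (fun i => (c i : ℂ)) * B y b).trace.re := by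
  obtain ⟨ι, _, _, c, e, f, hc, he, hf, hψ⟩ := TensorProduct.exists_schmidt S.ψ
  have hψ' : S.ψ = ∑ s, ∑ t, Matrix.diagonal (fun i => (c i : ℂ)) s t • (e s ⊗ₜ[ℂ] f t) := by
    rw [hψ]
    refine Finset.sum_congr rfl fun s _ => ?_
    simp [Matrix.diagonal_apply]
  have hD : (Matrix.diagonal (fun i => (c i : ℂ)))ᴴ = Matrix.diagonal (fun i => (c i : ℂ)) := by
    rw [Matrix.diagonal_conjTranspose]; congr 1; ext i; simp
  refine ⟨ι, inferInstance, inferInstance, c,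
    fun x a => Matrix.of fun s t => inner ℂ (e s) (S.MA x a (e t)),
    fun y b => (Matrix.of fun s t => inner ℂ (f s) (S.MB y b (f t)))ᵀ, hc, ?_,
    fun x a => ((S.povmA x).isPositive a).posSemidef_compression e, fun x => ?_,
    fun y b => (((S.povmB y).isPositive b).posSemidef_compression f).transpose, fun y => ?_, ?_⟩
  · have h := inner_map_sum_tmul (1 : S.HA →L[ℂ] S.HA) (1 : S.HB →L[ℂ] S.HB)
      (Matrix.diagonal (fun i => (c i : ℂ))) e f
    have h1 : TensorProduct.map (1 : S.HA →L[ℂ] S.HA).toLinearMap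
      (1 : S.HB →L[ℂ] S.HB).toLinearMap = LinearMap.id := TensorProduct.map_id
    have h0 : inner ℂ S.ψ S.ψ = ((‖S.ψ‖ : ℂ)) ^ 2 :=
      @inner_self_eq_norm_sq_to_K ℂ (S.HA ⊗[ℂ] S.HB) _ _ _ S.ψ
    rw [← hψ', h1, LinearMap.id_apply, h0, S.norm_ψ] at h
    simp only [one_apply_eq_self, orthonormal_iff_ite.1 he, orthonormal_iff_ite.1 hf]
      at h
    have h2 : (Matrix.of fun s t => if s = t then (1 : ℂ) else 0) = (1 : Matrix ι ι ℂ) := by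
      ext s t; simp [Matrix.one_apply]
    rw [h2, Matrix.transpose_one, Matrix.mul_one, Matrix.mul_one] at h
    rw [hD, Matrix.diagonal_mul_diagonal, Matrix.trace_diagonal] at h
    have h3 := congrArg Complex.re h
    simpa [sq] using h3.symm
  · have h := (S.povmA x).sum_eq_one
    ext s t
    simp only [Matrix.sum_apply, Matrix.of_apply, Matrix.one_apply, ← inner_sum]
    rw [← sum_apply, h, one_apply_eq_self,
      orthonormal_iff_ite.1 he]
  · have h := (S.povmB y).sum_eq_one
    ext s t
    simp only [Matrix.sum_apply, Matrix.of_apply, Matrix.transpose_apply, Matrix.one_apply,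
      ← inner_sum]
    rw [← sum_apply, h, one_apply_eq_self,
      orthonormal_iff_ite.1 hf, eq_comm]
    simp only [eq_comm]
  · intro x y a b
    rw [FinDimStrategy.prob, hψ', inner_map_sum_tmul]
    rw [hD]

theorem exists_finDimStrategy (G : NonlocalGame) {d : ℕ} (Q : Matrix (Fin d) (Fin d) ℂ)
    (hQ : ‖Q‖ = 1) (A : (x : G.X) → G.A x → Matrix (Fin d) (Fin d) ℂ)
    (B : (y : G.Y) → G.B y → Matrix (Fin d) (Fin d) ℂ)
    (hA : ∀ x a, (A x a).PosSemidef) (hA1 : ∀ x, ∑ a, A x a = 1)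
    (hB : ∀ y b, (B y b).PosSemidef) (hB1 : ∀ y, ∑ b, B y b = 1) :
    ∃ S : FinDimStrategy G, ∀ x y a b, S.prob x y a b = (Qᴴ * A x a * Q * B y b).trace.re := by
  let H := EuclideanSpace ℂ (Fin d)
  let e : Fin d → H := fun i => EuclideanSpace.single i 1
  have hM : ∀ M : Matrix (Fin d) (Fin d) ℂ, (Matrix.of fun s t => inner ℂ (e s)
      (Matrix.toEuclideanCLM (𝕜 := ℂ) M (e t))) = M := by
    intro M
    ext s t
    refine (EuclideanSpace.inner_single_left s 1 _).trans ?_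
    simp [e, Matrix.ofLp_toEuclideanCLM]
  have hpos : ∀ M : Matrix (Fin d) (Fin d) ℂ, M.PosSemidef →
      (Matrix.toEuclideanCLM (𝕜 := ℂ) M).IsPositive := by
    intro M hM
    rw [← ContinuousLinearMap.isPositive_toLinearMap_iff]
    exact Matrix.isPositive_toEuclideanLin_iff.2 hM
  let ψ : H ⊗[ℂ] H := ∑ s, ∑ t, Q s t • (e s ⊗ₜ[ℂ] e t)
  have hin : ∀ M N : Matrix (Fin d) (Fin d) ℂ, inner ℂ ψ (TensorProduct.map
      (Matrix.toEuclideanCLM (𝕜 := ℂ) M).toLinearMap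
      (Matrix.toEuclideanCLM (𝕜 := ℂ) N).toLinearMap ψ) = (Qᴴ * M * Q * Nᵀ).trace := by
    intro M N
    have := inner_map_sum_tmul (Matrix.toEuclideanCLM (𝕜 := ℂ) M)
      (Matrix.toEuclideanCLM (𝕜 := ℂ) N) Q e e
    rw [hM, hM] at this
    exact this
  refine ⟨{
    HA := H
    HB := H
    finite := Or.inl inferInstance
    ψ := ψ
    norm_ψ := ?_
    MA := fun x a => Matrix.toEuclideanCLM (𝕜 := ℂ) (A x a)
    -- This transpose cancels the one in `inner_map_sum_tmul`.
    MB := fun y b => Matrix.toEuclideanCLM (𝕜 := ℂ) (B y b)ᵀ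
    povmA := fun x => ⟨fun a => hpos _ (hA x a), ?_⟩
    povmB := fun y => ⟨fun b => hpos _ (hB y b).transpose, ?_⟩ }, ?_⟩
  · have h := hin 1 1
    rw [map_one] at h
    have h1 : TensorProduct.map (1 : H →L[ℂ] H).toLinearMap
      (1 : H →L[ℂ] H).toLinearMap = LinearMap.id := TensorProduct.map_id
    rw [h1, LinearMap.id_apply, Matrix.transpose_one, Matrix.mul_one, Matrix.mul_one] at h
    have h0 : inner ℂ ψ ψ = ((‖ψ‖ : ℂ)) ^ 2 :=
      @inner_self_eq_norm_sq_to_K ℂ (H ⊗[ℂ] H) _ _ _ ψ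
    have h2 := congrArg Complex.re h
    rw [← frobenius_sq_eq_trace, hQ, h0] at h2
    have h3 : ‖ψ‖ ^ 2 = 1 ^ 2 := by
      rw [← h2]; norm_cast
    exact (sq_eq_sq₀ (norm_nonneg _) zero_le_one).1 h3
  · rw [← map_sum, hA1, map_one]
  · rw [← map_sum, ← Matrix.transpose_sum, hB1, Matrix.transpose_one, map_one]
  · intro x y a b
    rw [FinDimStrategy.prob, hin, Matrix.transpose_transpose]

end Strategies

/-! ### Elementary bounds for the winning probability. -/

section WinningProbability

theorem Matrix.PosSemidef.trace_mul_re_nonneg {p : Type*} [Fintype p] [DecidableEq p]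
    {M N : Matrix p p ℂ} (hM : M.PosSemidef) (hN : N.PosSemidef) : 0 ≤ (M * N).trace.re := by
  obtain ⟨R, rfl⟩ := hN.exists_eq_conjTranspose_mul_self
  rw [← Matrix.mul_assoc, Matrix.trace_mul_comm, ← Matrix.mul_assoc]
  exact (hM.mul_mul_conjTranspose_same R).trace_re_nonneg

theorem diagonal_ofReal_conjTranspose {p : Type*} [DecidableEq p] (c : p → ℝ) :
    (Matrix.diagonal (fun i => (c i : ℂ)))ᴴ = Matrix.diagonal (fun i => (c i : ℂ)) := by
  rw [Matrix.diagonal_conjTranspose]; congr 1; ext i; simp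

namespace FinDimStrategy

variable {G : NonlocalGame} (S : FinDimStrategy G)

theorem prob_nonneg (x : G.X) (y : G.Y) (a : G.A x) (b : G.B y) : 0 ≤ S.prob x y a b := by
  obtain ⟨ι, _, _, c, A, B, -, -, hA, -, hB, -, h⟩ := S.exists_matrices
  rw [h]
  refine Matrix.PosSemidef.trace_mul_re_nonneg ?_ (hB y b)
  have := (hA x a).mul_mul_conjTranspose_same (Matrix.diagonal (fun i => (c i : ℂ)))
  rwa [diagonal_ofReal_conjTranspose] at this

theorem sum_prob (x : G.X) (y : G.Y) : ∑ a, ∑ b, S.prob x y a b = 1 := by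
  obtain ⟨ι, _, _, c, A, B, -, hc, -, hA, -, hB, h⟩ := S.exists_matrices
  simp only [h, ← Complex.re_sum, ← Matrix.trace_sum, ← Matrix.mul_sum, ← Matrix.sum_mul, hA, hB,
    Matrix.mul_one]
  rw [Matrix.diagonal_mul_diagonal, Matrix.trace_diagonal, ← hc]
  simp [sq]

open Classical in
theorem winProb_eq_one_sub : S.winProb =
    1 - ∑ x, ∑ y, G.π x y * ∑ a, ∑ b, (if G.V x y a b then 0 else 1) * S.prob x y a b := by
  rw [eq_sub_iff_add_eq, winProb, ← Finset.sum_add_distrib]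
  refine Eq.trans ?_ G.π_sum
  refine Finset.sum_congr rfl fun x _ => ?_
  rw [← Finset.sum_add_distrib]
  refine Finset.sum_congr rfl fun y _ => ?_
  rw [← mul_add, ← Finset.sum_add_distrib]
  conv_rhs => rw [← mul_one (G.π x y), ← S.sum_prob x y]
  congr 1
  refine Finset.sum_congr rfl fun a _ => ?_
  rw [← Finset.sum_add_distrib]
  refine Finset.sum_congr rfl fun b _ => ?_
  split_ifs <;> simp

theorem winProb_le_one : S.winProb ≤ 1 := by
  classical
  rw [winProb_eq_one_sub, sub_le_self_iff]
  refine Finset.sum_nonneg fun x _ => Finset.sum_nonneg fun y _ => mul_nonneg (G.π_nonneg x y)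
    (Finset.sum_nonneg fun a _ => Finset.sum_nonneg fun b _ => mul_nonneg ?_ (S.prob_nonneg x y a b))
  split_ifs <;> simp

theorem winProb_le_quantumValue : S.winProb ≤ quantumValue G :=
  le_ciSup (f := fun S : FinDimStrategy G => S.winProb)
    ⟨1, by rintro _ ⟨S, rfl⟩; exact S.winProb_le_one⟩ S

end FinDimStrategy

theorem quantumValue_le_one (G : NonlocalGame) : quantumValue G ≤ 1 :=
  Real.iSup_le (fun S => S.winProb_le_one) zero_le_one

end WinningProbability

/-! ### Relations in the group algebra along a sequence of representations. -/

section GroupAlgebra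

open Filter Topology

variable {S : Type*}

/-- The extension of a unitary representation to the group algebra. -/
noncomputable def groupAlgebraRep {F : Type*} [Group F] {d : ℕ}
    (φ : F →* Matrix.unitaryGroup (Fin d) ℂ) :
    MonoidAlgebra ℂ F →ₐ[ℂ] Matrix (Fin d) (Fin d) ℂ :=
  MonoidAlgebra.lift ℂ (Matrix (Fin d) (Fin d) ℂ) F
    ((Submonoid.subtype (Matrix.unitaryGroup (Fin d) ℂ)).comp φ)

theorem groupAlgebraRep_of {F : Type*} [Group F] {d : ℕ}
    (φ : F →* Matrix.unitaryGroup (Fin d) ℂ) (g : F) :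
    groupAlgebraRep φ (MonoidAlgebra.of ℂ F g) = (φ g : Matrix (Fin d) (Fin d) ℂ) := by
  rw [groupAlgebraRep, MonoidAlgebra.lift_of]; rfl

theorem normalizedFrobenius_nonneg {d : ℕ} (M : Matrix (Fin d) (Fin d) ℂ) :
    0 ≤ normalizedFrobenius M := by
  rw [normalizedFrobenius_eq]; positivity

theorem normalizedFrobenius_add_le {d : ℕ} (M N : Matrix (Fin d) (Fin d) ℂ) :
    normalizedFrobenius (M + N) ≤ normalizedFrobenius M + normalizedFrobenius N := by
  simp only [normalizedFrobenius_eq, ← add_div]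
  gcongr
  exact norm_add_le M N

theorem normalizedFrobenius_smul {d : ℕ} (c : ℂ) (M : Matrix (Fin d) (Fin d) ℂ) :
    normalizedFrobenius (c • M) = ‖c‖ * normalizedFrobenius M := by
  simp only [normalizedFrobenius_eq, norm_smul, mul_div_assoc]

theorem normalizedFrobenius_unitary_mul {d : ℕ} (U : Matrix.unitaryGroup (Fin d) ℂ)
    (M : Matrix (Fin d) (Fin d) ℂ) :
    normalizedFrobenius ((U : Matrix (Fin d) (Fin d) ℂ) * M) = normalizedFrobenius M := by
  simp only [normalizedFrobenius_eq]
  rw [frobenius_isometry_mul (Unitary.star_mul_self_of_mem U.2)]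

theorem normalizedFrobenius_mul_unitary {d : ℕ} (U : Matrix.unitaryGroup (Fin d) ℂ)
    (M : Matrix (Fin d) (Fin d) ℂ) :
    normalizedFrobenius (M * (U : Matrix (Fin d) (Fin d) ℂ)) = normalizedFrobenius M := by
  simp only [normalizedFrobenius_eq]
  rw [frobenius_mul_coisometry (Unitary.mul_star_self_of_mem U.2)]

variable {F : Type*} [Group F] {d : ℕ → ℕ}

/-- An element of the group algebra is asymptotically null for a sequence of unitary
representations if the normalized Frobenius norms of its images tend to zero. -/
def IsAsymptoticallyNull (φ : ∀ k, F →* Matrix.unitaryGroup (Fin (d k)) ℂ)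
    (a : MonoidAlgebra ℂ F) : Prop :=
  Tendsto (fun k => normalizedFrobenius (groupAlgebraRep (φ k) a)) atTop (𝓝 0)

namespace IsAsymptoticallyNull

variable {φ : ∀ k, F →* Matrix.unitaryGroup (Fin (d k)) ℂ}

theorem zero : IsAsymptoticallyNull φ 0 := by
  simp [IsAsymptoticallyNull, normalizedFrobenius_eq]

theorem add {a b : MonoidAlgebra ℂ F} (ha : IsAsymptoticallyNull φ a)
    (hb : IsAsymptoticallyNull φ b) : IsAsymptoticallyNull φ (a + b) := by
  refine squeeze_zero (fun _ => normalizedFrobenius_nonneg _) (fun k => ?_) (by simpa using Tendsto.add ha hb)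
  rw [map_add]
  exact normalizedFrobenius_add_le _ _

theorem smul {a : MonoidAlgebra ℂ F} (c : ℂ) (ha : IsAsymptoticallyNull φ a) :
    IsAsymptoticallyNull φ (c • a) := by
  have := Tendsto.const_mul ‖c‖ ha
  simpa only [IsAsymptoticallyNull, map_smul, normalizedFrobenius_smul, mul_zero] using this

theorem of_mul {a : MonoidAlgebra ℂ F} (g : F) (ha : IsAsymptoticallyNull φ a) :
    IsAsymptoticallyNull φ (MonoidAlgebra.of ℂ F g * a) := by
  simpa only [IsAsymptoticallyNull, map_mul, groupAlgebraRep_of,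
    normalizedFrobenius_unitary_mul] using ha

theorem mul_of {a : MonoidAlgebra ℂ F} (g : F) (ha : IsAsymptoticallyNull φ a) :
    IsAsymptoticallyNull φ (a * MonoidAlgebra.of ℂ F g) := by
  simpa only [IsAsymptoticallyNull, map_mul, groupAlgebraRep_of,
    normalizedFrobenius_mul_unitary] using ha

end IsAsymptoticallyNull

/-- The `w` with `w - 1` asymptotically null form a normal subgroup, because multiplication by
unitaries preserves the norm. -/
theorem isAsymptoticallyNull_of_sub_one {φ : ∀ k, F →* Matrix.unitaryGroup (Fin (d k)) ℂ}
    {R : Set F} (hR : ∀ r ∈ R, IsAsymptoticallyNull φ (MonoidAlgebra.of ℂ F r - 1)) {w : F}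
    (hw : w ∈ Subgroup.normalClosure R) :
    IsAsymptoticallyNull φ (MonoidAlgebra.of ℂ F w - 1) := by
  induction hw using Subgroup.closure_induction with
  | mem x hx =>
    obtain ⟨r, hr, hx⟩ := Group.mem_conjugatesOfSet_iff.1 hx
    obtain ⟨c, rfl⟩ := isConj_iff.1 hx
    have e : MonoidAlgebra.of ℂ F (c * r * c⁻¹) - 1 =
        MonoidAlgebra.of ℂ F c * (MonoidAlgebra.of ℂ F r - 1) * MonoidAlgebra.of ℂ F c⁻¹ := by
      rw [mul_sub, sub_mul, ← map_mul, ← map_mul, mul_one, ← map_mul, mul_inv_cancel, map_one]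
    rw [e]
    exact ((hR r hr).of_mul c).mul_of c⁻¹
  | one =>
    rw [map_one, sub_self]
    exact IsAsymptoticallyNull.zero
  | mul x y _ _ hx hy =>
    have e : MonoidAlgebra.of ℂ F (x * y) - 1 = MonoidAlgebra.of ℂ F x *
        (MonoidAlgebra.of ℂ F y - 1) + (MonoidAlgebra.of ℂ F x - 1) := by
      rw [map_mul, mul_sub, mul_one]; abel
    rw [e]
    exact (hy.of_mul x).add hx
  | inv x _ hx =>
    have e : MonoidAlgebra.of ℂ F x⁻¹ - 1 = (-1 : ℂ) • (MonoidAlgebra.of ℂ F x⁻¹ *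
        (MonoidAlgebra.of ℂ F x - 1)) := by
      rw [mul_sub, ← map_mul, inv_mul_cancel, map_one, mul_one, neg_one_smul, neg_sub]
    rw [e]
    exact (hx.of_mul x⁻¹).smul (-1)

/-- With a set-theoretic section `σ` of the quotient map, each `g` differs from `σ (mk g)` by `σ (mk
g) * (w - 1)` with `w` in the normal closure of `R`. By linearity `a` is asymptotically equal to the
lift of its image, which is zero. -/
theorem isAsymptoticallyNull_of_map_eq_zero {S : Type*} {R : Set (FreeGroup S)}
    {φ : ∀ k, FreeGroup S →* Matrix.unitaryGroup (Fin (d k)) ℂ}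
    (hR : ∀ r ∈ R, IsAsymptoticallyNull φ (MonoidAlgebra.of ℂ _ r - 1))
    {a : MonoidAlgebra ℂ (FreeGroup S)}
    (ha : MonoidAlgebra.mapDomainAlgHom ℂ ℂ (PresentedGroup.mk R) a = 0) :
    IsAsymptoticallyNull φ a := by
  let σ := Function.surjInv (PresentedGroup.mk_surjective R)
  have key : ∀ a : MonoidAlgebra ℂ (FreeGroup S), IsAsymptoticallyNull φ
      (a - MonoidAlgebra.mapDomain σ
        (MonoidAlgebra.mapDomainAlgHom ℂ ℂ (PresentedGroup.mk R) a)) := by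
    intro a
    induction a using MonoidAlgebra.induction_linear with
    | zero => simpa using IsAsymptoticallyNull.zero
    | add x y hx hy =>
      rw [map_add, MonoidAlgebra.mapDomain_add, add_sub_add_comm]
      exact hx.add hy
    | single g c =>
      have h1 : σ (PresentedGroup.mk R g) * ((σ (PresentedGroup.mk R g))⁻¹ * g) = g := by simp
      have hw : (σ (PresentedGroup.mk R g))⁻¹ * g ∈ Subgroup.normalClosure R := by
        rw [← PresentedGroup.mk_eq_one_iff, map_mul, map_inv,
          Function.surjInv_eq (PresentedGroup.mk_surjective R), inv_mul_cancel]
      convert ((isAsymptoticallyNull_of_sub_one hR hw).of_mul (σ (PresentedGroup.mk R g))).smul c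
        using 1
      rw [mul_sub, ← map_mul, h1]
      simp [smul_sub]
  simpa [ha, MonoidAlgebra.mapDomain_zero] using key a

end GroupAlgebra

/-! ### Sequential measurement of commuting involutions. -/

section SequentialMeasurement

/-- The character `z ↦ (-1)^z` of `ℤ₂`. -/
noncomputable def parity (z : ZMod 2) : ℂ := (-1) ^ z.val

theorem parity_zero : parity 0 = 1 := by simp [parity]

theorem parity_one : parity 1 = -1 := by simp [parity, ZMod.val_one]

theorem parity_add (y z : ZMod 2) : parity (y + z) = parity y * parity z := by
  have h : ∀ y z : ZMod 2, (y + z).val % 2 = (y.val + z.val) % 2 := by decide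
  rw [parity, parity, parity, ← pow_add, neg_one_pow_eq_pow_mod_two, h,
    ← neg_one_pow_eq_pow_mod_two]

theorem parity_mul_self (z : ZMod 2) : parity z * parity z = 1 := by
  rw [← parity_add, CharTwo.add_self_eq_zero, parity_zero]

theorem parity_eq_neg_of_ne {y z : ZMod 2} (h : y ≠ z) : parity y = -parity z := by
  have : y = z + 1 := by revert y z; decide
  rw [this, parity_add, parity_one, mul_neg_one]

theorem parity_sum {ι : Type*} (s : Finset ι) (y : ι → ZMod 2) :
    parity (∑ i ∈ s, y i) = ∏ i ∈ s, parity (y i) := by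
  classical
  induction s using Finset.induction_on with
  | empty => simp [parity_zero]
  | insert a s ha ih => rw [Finset.sum_insert ha, Finset.prod_insert ha, parity_add, ih]

theorem star_parity (z : ZMod 2) : star (parity z) = parity z := by
  simp [parity]

theorem sum_zmod_two {M : Type*} [AddCommMonoid M] (f : ZMod 2 → M) : ∑ z, f z = f 0 + f 1 :=
  Fin.sum_univ_two f

theorem parity_ne_zero (z : ZMod 2) : parity z ≠ 0 := fun h => by
  simpa [h] using parity_mul_self z

variable {R : Type*} [Ring R] [Algebra ℂ R]

/-- `(1 + (-1)^z g) / 2`, the spectral projection of `g` for the eigenvalue `(-1)^z` if `g` is an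
involution. -/
noncomputable def halfProj (g : R) (z : ZMod 2) : R := (1 / 2 : ℂ) • (1 + parity z • g)

/-- The ordered product of the operators `halfProj (g a) (y a)`. -/
noncomputable def seqProj {k : ℕ} (g : Fin k → R) (y : Fin k → ZMod 2) : R :=
  (List.ofFn fun a => halfProj (g a) (y a)).prod

theorem map_halfProj {R' : Type*} [Ring R'] [Algebra ℂ R'] (f : R →ₐ[ℂ] R') (g : R) (z : ZMod 2) :
    f (halfProj g z) = halfProj (f g) z := by
  simp [halfProj]

theorem map_seqProj {R' : Type*} [Ring R'] [Algebra ℂ R'] (f : R →ₐ[ℂ] R') {k : ℕ}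
    (g : Fin k → R) (y : Fin k → ZMod 2) : f (seqProj g y) = seqProj (fun a => f (g a)) y := by
  simp only [seqProj, map_list_prod, List.map_ofFn, Function.comp_def, map_halfProj]

theorem seqProj_succ {k : ℕ} (g : Fin (k + 1) → R) (y : Fin (k + 1) → ZMod 2) :
    seqProj g y = halfProj (g 0) (y 0) * seqProj (fun a => g a.succ) (fun a => y a.succ) := by
  simp [seqProj, List.ofFn_succ]

theorem commute_halfProj {h g : R} (hg : Commute h g) (z : ZMod 2) : Commute h (halfProj g z) :=
  ((Commute.one_right h).add_right (hg.smul_right _)).smul_right _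

theorem commute_seqProj {k : ℕ} {h : R} {g : Fin k → R} (hg : ∀ a, Commute h (g a))
    (y : Fin k → ZMod 2) : Commute h (seqProj g y) := by
  refine Commute.list_prod_right _ _ fun x hx => ?_
  obtain ⟨a, rfl⟩ := List.mem_ofFn.1 hx
  exact commute_halfProj (hg a) _

theorem mul_halfProj_self {g : R} (hg : g * g = 1) (z : ZMod 2) :
    g * halfProj g z = parity z • halfProj g z := by
  rw [halfProj, mul_smul_comm, mul_add, mul_smul_comm, hg, mul_one, smul_comm (parity z),
    smul_add (parity z), smul_smul (parity z), parity_mul_self, one_smul, add_comm]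

theorem halfProj_mul_eq_zero {g K : R} {y z : ZMod 2} (hK : g * K = parity y • K) (h : y ≠ z) :
    halfProj g z * K = 0 := by
  rw [halfProj, smul_mul_assoc, add_mul, smul_mul_assoc, hK, one_mul, smul_smul,
    parity_eq_neg_of_ne h, mul_neg, parity_mul_self, neg_one_smul, add_neg_cancel, smul_zero]

theorem mul_seqProj {k : ℕ} {g : Fin k → R} (hg : ∀ a, g a * g a = 1)
    (hc : ∀ a a', Commute (g a) (g a')) (y : Fin k → ZMod 2) (a : Fin k) :
    g a * seqProj g y = parity (y a) • seqProj g y := by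
  induction k with
  | zero => exact a.elim0
  | succ k ih =>
    rw [seqProj_succ]
    refine Fin.cases ?_ (fun a => ?_) a
    · rw [← mul_assoc, mul_halfProj_self (hg 0), smul_mul_assoc]
    · rw [← mul_assoc, (commute_halfProj (hc a.succ 0) _).eq, mul_assoc,
        ih (g := fun a => g a.succ) (fun a => hg _) (fun a a' => hc _ _) (fun a => y a.succ) a,
        mul_smul_comm]

theorem list_ofFn_prod_mul {k : ℕ} {g : Fin k → R} {c : Fin k → ℂ} {K : R}
    (h : ∀ a, g a * K = c a • K) : (List.ofFn g).prod * K = (∏ a, c a) • K := by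
  induction k with
  | zero => simp
  | succ k ih =>
    rw [List.ofFn_succ, List.prod_cons, mul_assoc, ih fun a => h a.succ, mul_smul_comm, h 0,
      smul_smul, Fin.prod_univ_succ, mul_comm]

theorem pow_val_mul {J K : R} (hJ : J * K = -K) (b : ZMod 2) : J ^ b.val * K = parity b • K := by
  rw [parity]
  generalize b.val = k
  induction k with
  | zero => simp
  | succ k ih => rw [pow_succ, mul_assoc, hJ, mul_neg, ih, pow_succ, mul_neg_one, neg_smul]

/-- On `K = seqProj g y * halfProj J 1` the product of the `g a` acts as `parity (∑ y)`, while `J ^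
b` acts as `parity b`, the opposite sign. Hence `2 K = 0`. -/
theorem seqProj_mul_eq_zero_of_sum_ne {k : ℕ} {g : Fin k → R} (hg : ∀ a, g a * g a = 1)
    (hc : ∀ a a', Commute (g a) (g a')) {J : R} (hJ : J * J = 1) (hJc : ∀ a, Commute J (g a))
    {b : ZMod 2} (hprod : (List.ofFn g).prod = J ^ b.val) {y : Fin k → ZMod 2}
    (hy : ∑ a, y a ≠ b) : seqProj g y * halfProj J 1 = 0 := by
  have hJK : J * (seqProj g y * halfProj J 1) = -(seqProj g y * halfProj J 1) := by
    rw [← mul_assoc, (commute_seqProj hJc y).eq, mul_assoc, mul_halfProj_self hJ, parity_one,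
      mul_smul_comm, neg_one_smul]
  have h1 := pow_val_mul hJK b
  have h2 : (List.ofFn g).prod * (seqProj g y * halfProj J 1) =
      parity (∑ a, y a) • (seqProj g y * halfProj J 1) := by
    rw [parity_sum]
    refine list_ofFn_prod_mul fun a => ?_
    rw [← mul_assoc, mul_seqProj hg hc, smul_mul_assoc]
  rw [hprod, h1, parity_eq_neg_of_ne hy, neg_smul, eq_neg_iff_add_eq_zero, ← add_smul,
    ← two_mul] at h2
  have := congrArg (fun x => (2 * parity b)⁻¹ • x) h2
  simpa [smul_smul, parity_ne_zero] using this

/-- All factors commute, and `seqProj g y` consists of eigenvectors of `g a` for the eigenvalue that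
`halfProj (g a) z` kills. -/
theorem seqProj_mul_eq_zero_of_ne {k : ℕ} {g : Fin k → R} (hg : ∀ a, g a * g a = 1)
    (hc : ∀ a a', Commute (g a) (g a')) {J : R} (hJc : ∀ a, Commute J (g a))
    {y : Fin k → ZMod 2} {a : Fin k} {z : ZMod 2} (hy : y a ≠ z) :
    seqProj g y * halfProj J 1 * halfProj (g a) z = 0 := by
  have h1 : Commute (halfProj (g a) z) (halfProj J 1) :=
    commute_halfProj (commute_halfProj (hJc a) z).symm 1
  have h2 : Commute (halfProj (g a) z) (seqProj g y) :=
    commute_seqProj (fun a' => (commute_halfProj (hc a' a) z).symm) y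
  rw [mul_assoc, ← h1.eq, ← mul_assoc, ← h2.eq,
    halfProj_mul_eq_zero (mul_seqProj hg hc y a) hy, zero_mul]

/-- Unitarity is enough, without `U² = 1`: the cross terms `parity z • (Vᴴ + V)` cancel in the sum
over `z`. -/
theorem sum_halfProj_conjTranspose_mul {d : ℕ} (U : Matrix.unitaryGroup (Fin d) ℂ) :
    ∑ z, (halfProj (U : Matrix (Fin d) (Fin d) ℂ) z)ᴴ * halfProj (U : Matrix (Fin d) (Fin d) ℂ) z
      = 1 := by
  have hU : (U : Matrix (Fin d) (Fin d) ℂ)ᴴ * U = 1 := Unitary.star_mul_self_of_mem U.2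
  set V : Matrix (Fin d) (Fin d) ℂ := (U : Matrix (Fin d) (Fin d) ℂ)
  have h : ∀ z, (halfProj V z)ᴴ * halfProj V z =
      (1 / 4 : ℂ) • ((2 : ℂ) • (1 : Matrix (Fin d) (Fin d) ℂ) + parity z • (Vᴴ + V)) := by
    intro z
    simp only [halfProj, Matrix.conjTranspose_smul, Matrix.conjTranspose_add,
      Matrix.conjTranspose_one, star_parity]
    rw [smul_mul_smul_comm, add_mul, mul_add, mul_add, smul_mul_smul_comm, parity_mul_self, hU]
    simp only [one_mul, mul_one, smul_add]
    norm_num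
    module
  rw [sum_zmod_two, h, h, parity_zero, parity_one]
  module

theorem sum_seqProj_conjTranspose_mul {d k : ℕ} (U : Fin k → Matrix.unitaryGroup (Fin d) ℂ) :
    ∑ y, (seqProj (fun a => (U a : Matrix (Fin d) (Fin d) ℂ)) y)ᴴ *
      seqProj (fun a => (U a : Matrix (Fin d) (Fin d) ℂ)) y = 1 := by
  induction k with
  | zero => simp [seqProj]
  | succ k ih =>
    -- The factor for the first answer is innermost in `Kᴴ * K`, so it is summed first and collapses
    -- to the identity.
    rw [← (Fin.consEquiv fun _ => ZMod 2).sum_comp, Fintype.sum_prod_type, Finset.sum_comm,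
      ← ih fun a => U a.succ]
    refine Finset.sum_congr rfl fun y _ => ?_
    simp only [seqProj_succ, Fin.consEquiv_apply, Fin.cons_zero, Fin.cons_succ,
      Matrix.conjTranspose_mul]
    have : ∀ A B C D : Matrix (Fin d) (Fin d) ℂ, A * B * (C * D) = A * (B * C) * D := by
      intro A B C D; simp only [Matrix.mul_assoc]
    simp only [this]
    rw [← Matrix.sum_mul, ← Matrix.mul_sum, sum_halfProj_conjTranspose_mul, Matrix.mul_one]

end SequentialMeasurement

/-! ### Specialisation to linear system games. -/

section LinearSystemStrategies

variable {m n : ℕ} [NeZero m] [NeZero n] {A : Matrix (Fin m) (Fin n) (ZMod 2)} {b : Fin m → ZMod 2}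

/-- The winning condition of the linear system game. -/
def IsWinning (A : Matrix (Fin m) (Fin n) (ZMod 2)) (b : Fin m → ZMod 2) (i : Fin m) (j : Fin n)
    (y : {j // j ∈ eqnVars A i} → ZMod 2) (z : ZMod 2) : Prop :=
  ∑ k, y k = b i ∧ ∀ h : j ∈ eqnVars A i, y ⟨j, h⟩ = z

/-- The probability of the answers `y`, `z` to the questions `i`, `j` of the linear system game. -/
noncomputable def answerProb (S : FinDimStrategy (linearSystemGame A b)) (i : Fin m) (j : Fin n)
    (y : {j // j ∈ eqnVars A i} → ZMod 2) (z : ZMod 2) : ℝ :=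
  FinDimStrategy.prob S i j y z

open Classical in
theorem winProb_linearSystemGame (S : FinDimStrategy (linearSystemGame A b)) :
    S.winProb = 1 - ∑ i : Fin m, ∑ j : Fin n, 1 / ((m : ℝ) * (n : ℝ)) *
      ∑ y, ∑ z, (if IsWinning A b i j y z then 0 else 1) * answerProb S i j y z :=
  S.winProb_eq_one_sub

theorem exists_linearSystemGame_strategy (A : Matrix (Fin m) (Fin n) (ZMod 2))
    (b : Fin m → ZMod 2) {d : ℕ} (Q : Matrix (Fin d) (Fin d) ℂ) (hQ : ‖Q‖ = 1)
    (MA : (i : Fin m) → ({j // j ∈ eqnVars A i} → ZMod 2) → Matrix (Fin d) (Fin d) ℂ)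
    (MB : Fin n → ZMod 2 → Matrix (Fin d) (Fin d) ℂ)
    (hA : ∀ i y, (MA i y).PosSemidef) (hA1 : ∀ i, ∑ y, MA i y = 1)
    (hB : ∀ j z, (MB j z).PosSemidef) (hB1 : ∀ j, ∑ z, MB j z = 1) :
    ∃ S : FinDimStrategy (linearSystemGame A b), ∀ i j y z,
      answerProb S i j y z = (Qᴴ * MA i y * Q * MB j z).trace.re :=
  exists_finDimStrategy (linearSystemGame A b) Q hQ MA MB hA hA1 hB hB1

theorem exists_matrices_answerProb (S : FinDimStrategy (linearSystemGame A b)) :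
    ∃ (ι : Type) (_ : Fintype ι) (_ : DecidableEq ι) (c : ι → ℝ)
      (MA : (i : Fin m) → ({j // j ∈ eqnVars A i} → ZMod 2) → Matrix ι ι ℂ)
      (MB : Fin n → ZMod 2 → Matrix ι ι ℂ),
      (∀ i, 0 < c i) ∧ ∑ i, c i ^ 2 = 1 ∧
      (∀ i y, (MA i y).PosSemidef) ∧ (∀ i, ∑ y, MA i y = 1) ∧
      (∀ j z, (MB j z).PosSemidef) ∧ (∀ j, ∑ z, MB j z = 1) ∧
      ∀ i j y z, answerProb S i j y z = (Matrix.diagonal (fun i => (c i : ℂ)) * MA i y *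
        Matrix.diagonal (fun i => (c i : ℂ)) * MB j z).trace.re :=
  S.exists_matrices

theorem answerProb_nonneg (S : FinDimStrategy (linearSystemGame A b)) (i : Fin m) (j : Fin n)
    (y : {j // j ∈ eqnVars A i} → ZMod 2) (z : ZMod 2) : 0 ≤ answerProb S i j y z :=
  S.prob_nonneg i j y z

end LinearSystemStrategies

/-! ### From approximate representations to strategies. -/

section ApproxRepToStrategy

open Filter Topology SolutionGroup

variable {m n : ℕ} (A : Matrix (Fin m) (Fin n) (ZMod 2)) (b : Fin m → ZMod 2)

/-- The increasing enumeration of the variables of equation `i`. -/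
def eqnEnum (i : Fin m) : Fin (eqnVars A i).card → Fin n := (eqnVars A i).orderEmbOfFin rfl

theorem eqnProd_eq_ofFn (i : Fin m) :
    eqnProd A i = (List.ofFn fun a => SolutionGroup.x (eqnEnum A i a)).prod := by
  rw [eqnProd, ← Finset.listMap_orderEmbOfFin_finRange _ rfl, List.map_map, List.ofFn_eq_map]
  rfl

/-- Alice's operator for the answer `y` to equation `i`, in a `ℂ`-algebra with elements `g j` for
the variables. -/
noncomputable def aliceOp {R : Type*} [Ring R] [Algebra ℂ R] (g : Fin n → R) (i : Fin m)
    (y : {j // j ∈ eqnVars A i} → ZMod 2) : R :=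
  seqProj (fun a => g (eqnEnum A i a)) (fun a => y ((eqnVars A i).orderIsoOfFin rfl a))

theorem sum_aliceOp_conjTranspose_mul {d : ℕ} (U : Fin n → Matrix.unitaryGroup (Fin d) ℂ)
    (i : Fin m) : ∑ y, (aliceOp A (fun j => (U j : Matrix (Fin d) (Fin d) ℂ)) i y)ᴴ *
      aliceOp A (fun j => (U j : Matrix (Fin d) (Fin d) ℂ)) i y = 1 := by
  rw [← sum_seqProj_conjTranspose_mul fun a => U (eqnEnum A i a)]
  exact Fintype.sum_equiv (Equiv.arrowCongr ((eqnVars A i).orderIsoOfFin rfl).toEquiv.symm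
    (Equiv.refl _)) _ _ fun y => rfl

/-- The image of a generator in the complex group algebra of the solution group. -/
noncomputable def solutionGen (o : Option (Fin n)) : MonoidAlgebra ℂ (SolutionGroup A b) :=
  MonoidAlgebra.of ℂ _ (PresentedGroup.of o)

theorem mk_eq_mk_of_isRelator {u v : FreeGroup (Option (Fin n))}
    (h : u * v⁻¹ ∈ relators A b) :
    PresentedGroup.mk (relators A b) u = PresentedGroup.mk (relators A b) v := by
  have := PresentedGroup.one_of_mem h
  rwa [map_mul, map_inv, mul_inv_eq_one] at this

theorem commute_of_isRelator {u v : FreeGroup (Option (Fin n))}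
    (h : u * v * u⁻¹ * v⁻¹ ∈ relators A b) :
    Commute (PresentedGroup.mk (relators A b) u) (PresentedGroup.mk (relators A b) v) := by
  have := PresentedGroup.one_of_mem h
  rwa [map_mul, map_mul, map_mul, map_inv, map_inv, mul_inv_eq_one, mul_inv_eq_iff_eq_mul] at this

theorem solutionGen_none_mul_self : solutionGen A b none * solutionGen A b none = 1 := by
  have h := PresentedGroup.one_of_mem (rels := relators A b) IsRelator.J_sq
  rw [solutionGen, ← map_mul, ← sq]
  exact (congrArg _ h).trans (map_one _)

theorem solutionGen_some_mul_self (j : Fin n) :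
    solutionGen A b (some j) * solutionGen A b (some j) = 1 := by
  have h := PresentedGroup.one_of_mem (rels := relators A b) (IsRelator.x_sq j)
  rw [solutionGen, ← map_mul, ← sq]
  exact (congrArg _ h).trans (map_one _)

theorem commute_solutionGen_none (j : Fin n) :
    Commute (solutionGen A b none) (solutionGen A b (some j)) :=
  ((commute_of_isRelator A b (IsRelator.x_comm_J j)).map (MonoidAlgebra.of ℂ _)).symm

theorem commute_solutionGen_some (i : Fin m) {j j' : Fin n} (hj : j ∈ eqnVars A i)
    (hj' : j' ∈ eqnVars A i) : Commute (solutionGen A b (some j)) (solutionGen A b (some j')) :=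
  (commute_of_isRelator A b (IsRelator.x_comm_x i j j' hj hj')).map (MonoidAlgebra.of ℂ _)

theorem prod_solutionGen (i : Fin m) :
    (List.ofFn fun a => solutionGen A b (some (eqnEnum A i a))).prod =
      solutionGen A b none ^ (b i).val := by
  have h := mk_eq_mk_of_isRelator A b (IsRelator.eqn i)
  rw [eqnProd_eq_ofFn, map_list_prod, List.map_ofFn, map_pow] at h
  have h2 := congrArg (MonoidAlgebra.of ℂ (SolutionGroup A b)) h
  rw [map_list_prod, List.map_ofFn, map_pow] at h2
  exact h2

theorem eqnEnum_mem (i : Fin m) (a : Fin (eqnVars A i).card) : eqnEnum A i a ∈ eqnVars A i :=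
  Finset.orderEmbOfFin_mem _ _ _

/-- The operator whose norm is the probability amplitude of the answers `y`, `z`. -/
noncomputable def amplitude {R : Type*} [Ring R] [Algebra ℂ R] (g : Option (Fin n) → R)
    (i : Fin m) (j : Fin n) (y : {j // j ∈ eqnVars A i} → ZMod 2) (z : ZMod 2) : R :=
  aliceOp A (fun j => g (some j)) i y * halfProj (g none) 1 * halfProj (g (some j)) z

theorem map_amplitude {R R' : Type*} [Ring R] [Algebra ℂ R] [Ring R'] [Algebra ℂ R']
    (f : R →ₐ[ℂ] R') (g : Option (Fin n) → R) (i : Fin m) (j : Fin n)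
    (y : {j // j ∈ eqnVars A i} → ZMod 2) (z : ZMod 2) :
    f (amplitude A g i j y z) = amplitude A (fun o => f (g o)) i j y z := by
  simp only [amplitude, aliceOp, map_mul, map_seqProj, map_halfProj]

theorem amplitude_solutionGen_eq_zero (i : Fin m) (j : Fin n)
    (y : {j // j ∈ eqnVars A i} → ZMod 2) (z : ZMod 2)
    (h : ¬ IsWinning A b i j y z) :
    amplitude A (solutionGen A b) i j y z = 0 := by
  have hg : ∀ a, solutionGen A b (some (eqnEnum A i a)) * solutionGen A b (some (eqnEnum A i a))
    = 1 := fun a => solutionGen_some_mul_self A b _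
  have hc : ∀ a a', Commute (solutionGen A b (some (eqnEnum A i a)))
      (solutionGen A b (some (eqnEnum A i a'))) := fun a a' =>
    commute_solutionGen_some A b i (eqnEnum_mem A i a) (eqnEnum_mem A i a')
  have hJ := solutionGen_none_mul_self A b
  have hJc : ∀ a, Commute (solutionGen A b none) (solutionGen A b (some (eqnEnum A i a))) :=
    fun a => commute_solutionGen_none A b _
  by_cases hs : ∑ k, y k = b i
  · obtain ⟨hj, hz⟩ := not_forall.1 (not_and.1 h hs)
    obtain ⟨a, ha⟩ := ((eqnVars A i).orderIsoOfFin rfl).surjective ⟨j, hj⟩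
    have ha' : eqnEnum A i a = j := congrArg Subtype.val ha
    rw [amplitude, aliceOp, ← ha']
    refine seqProj_mul_eq_zero_of_ne hg hc hJc (a := a) ?_
    rwa [ha]
  · rw [amplitude, aliceOp, seqProj_mul_eq_zero_of_sum_ne hg hc hJ hJc (prod_solutionGen A b i),
      zero_mul]
    exact fun h0 => hs ((((eqnVars A i).orderIsoOfFin rfl).toEquiv.sum_comp y).symm.trans h0)

/-- The state is `Q = (1 - φ J)/2` divided by its norm. With effects `Kᴴ K` for Alice and `E Eᴴ` for
Bob the trace formula becomes `‖K Q E‖² / ‖Q‖²`; dimension factors cancel in the quotient. -/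
theorem exists_strategy_of_rep [NeZero m] [NeZero n] {d : ℕ} (hd : 0 < d)
    (φ : FreeGroup (Option (Fin n)) →* Matrix.unitaryGroup (Fin d) ℂ)
    (hφ : (φ J : Matrix (Fin d) (Fin d) ℂ) ≠ 1) :
    ∃ S : FinDimStrategy (linearSystemGame A b), ∀ i j y z,
      answerProb S i j y z =
      (normalizedFrobenius (groupAlgebraRep φ
        (amplitude A (fun o => MonoidAlgebra.of ℂ _ (FreeGroup.of o)) i j y z)) /
        (normalizedFrobenius ((φ J : Matrix (Fin d) (Fin d) ℂ) - 1) / 2)) ^ 2 := by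
  let U : Option (Fin n) → Matrix.unitaryGroup (Fin d) ℂ := fun o => φ (FreeGroup.of o)
  let W : Option (Fin n) → Matrix (Fin d) (Fin d) ℂ := fun o => U o
  set Q : Matrix (Fin d) (Fin d) ℂ := halfProj (W none) 1 with hQdef
  have hQJ : Q = (-1 / 2 : ℂ) • ((φ J : Matrix (Fin d) (Fin d) ℂ) - 1) := by
    rw [hQdef, halfProj, parity_one]
    change (1 / 2 : ℂ) • (1 + (-1 : ℂ) • (φ J : Matrix (Fin d) (Fin d) ℂ)) = _
    module
  have hQ : ‖Q‖ ≠ 0 := by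
    rw [norm_ne_zero_iff, hQJ]
    exact smul_ne_zero (by norm_num) (sub_ne_zero.2 hφ)
  have hQn : normalizedFrobenius ((φ J : Matrix (Fin d) (Fin d) ℂ) - 1) / 2 =
      normalizedFrobenius Q := by
    rw [hQJ, normalizedFrobenius_smul]; norm_num; ring
  obtain ⟨S, hS⟩ := exists_linearSystemGame_strategy A b ((‖Q‖⁻¹ : ℂ) • Q)
    (by rw [norm_smul, norm_inv, Complex.norm_real, norm_norm, inv_mul_cancel₀ hQ])
    (fun i y => (aliceOp A (fun j => W (some j)) i y)ᴴ * aliceOp A (fun j => W (some j)) i y)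
    (fun j z => (halfProj (W (some j)) z) * (halfProj (W (some j)) z)ᴴ)
    (fun i y => Matrix.posSemidef_conjTranspose_mul_self _)
    (fun i => sum_aliceOp_conjTranspose_mul A (fun j => U (some j)) i)
    (fun j z => Matrix.posSemidef_self_mul_conjTranspose _)
    (fun j => by
      -- A linear combination of 1 and a unitary is normal, so `E Eᴴ = Eᴴ E`, for which completeness
      -- is known.
      have hcomm : ∀ z, halfProj (W (some j)) z * (halfProj (W (some j)) z)ᴴ =
          (halfProj (W (some j)) z)ᴴ * halfProj (W (some j)) z := by
        intro z
        have h1 : Commute (W (some j)) (W (some j))ᴴ :=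
          (Unitary.mul_star_self_of_mem (U (some j)).2).trans
            (Unitary.star_mul_self_of_mem (U (some j)).2).symm
        simp only [halfProj, Matrix.conjTranspose_smul, Matrix.conjTranspose_add,
          Matrix.conjTranspose_one]
        exact ((((Commute.one_left _).add_left (Commute.add_right (Commute.one_right _)
          ((h1.smul_left _).smul_right _)))).smul_left _).smul_right _
      refine (Finset.sum_congr rfl fun z _ => hcomm z).trans ?_
      exact sum_halfProj_conjTranspose_mul (U (some j)))
  refine ⟨S, fun i j y z => ?_⟩
  have hrep : groupAlgebraRep φ
      (amplitude A (fun o => MonoidAlgebra.of ℂ _ (FreeGroup.of o)) i j y z) =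
      amplitude A W i j y z := by
    rw [map_amplitude]; simp only [groupAlgebraRep_of]; rfl
  have hd' : (0 : ℝ) < √d := Real.sqrt_pos.2 (by exact_mod_cast hd)
  rw [hS, hrep, hQn, normalizedFrobenius_eq, normalizedFrobenius_eq,
    div_div_div_cancel_right₀ hd'.ne', div_pow, frobenius_sq_eq_trace (amplitude A W i j y z),
    amplitude, ← hQdef]
  set K := aliceOp A (fun j => W (some j)) i y
  set E := halfProj (W (some j)) z
  rw [Matrix.conjTranspose_smul, Matrix.conjTranspose_mul, Matrix.conjTranspose_mul]
  have e : star ((‖Q‖ : ℂ)⁻¹) = (‖Q‖ : ℂ)⁻¹ := by simp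
  rw [e]
  simp only [Matrix.smul_mul, Matrix.mul_smul, smul_smul, Matrix.trace_smul]
  have e2 : (Qᴴ * (Kᴴ * K) * Q * (E * Eᴴ)).trace = (Eᴴ * (Qᴴ * Kᴴ) * (K * Q * E)).trace := by
    rw [← Matrix.mul_assoc (Qᴴ * (Kᴴ * K) * Q), Matrix.trace_mul_comm]
    simp only [Matrix.mul_assoc]
  rw [e2]
  have e3 : ((‖Q‖ : ℂ)⁻¹ * (‖Q‖ : ℂ)⁻¹) = (((‖Q‖ ^ 2)⁻¹ : ℝ) : ℂ) := by push_cast; ring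
  rw [e3, smul_eq_mul, Complex.re_ofReal_mul, div_eq_inv_mul]

theorem quantumValue_eq_one_of_nontrivialInApproxReps [NeZero m] [NeZero n]
    (h : NontrivialInApproxReps (relators A b) (genJ A b)) :
    quantumValue (linearSystemGame A b) = 1 := by
  classical
  refine le_antisymm (quantumValue_le_one _) ?_
  obtain ⟨w, hw, δ, hδ, h⟩ := h
  choose d hd φ hφ hφw using fun k : ℕ => h (1 / ((k : ℝ) + 1)) (by positivity)
  have hR : ∀ r ∈ relators A b, IsAsymptoticallyNull φ (MonoidAlgebra.of ℂ _ r - 1) := by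
    intro r hr
    refine squeeze_zero (fun _ => normalizedFrobenius_nonneg _) (fun k => ?_)
      tendsto_one_div_add_atTop_nhds_zero_nat
    rw [map_sub, map_one, groupAlgebraRep_of]
    exact hφ k r hr
  -- The given representative `w` need not be the free generator `J`; the difference is
  -- asymptotically null, so half of the lower bound `δ` survives for `J`.
  have hwJ : IsAsymptoticallyNull φ (MonoidAlgebra.of ℂ _ w - MonoidAlgebra.of ℂ _ J) := by
    refine isAsymptoticallyNull_of_map_eq_zero hR ?_
    have hw' : PresentedGroup.mk (relators A b) w = PresentedGroup.mk (relators A b) J := hw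
    rw [map_sub, sub_eq_zero]
    simp [hw']
  have hamp : ∀ (i : Fin m) (j : Fin n) y z,
      ¬ IsWinning A b i j y z → IsAsymptoticallyNull φ
        (amplitude A (fun o => MonoidAlgebra.of ℂ _ (FreeGroup.of o)) i j y z) := by
    intro i j y z hV
    refine isAsymptoticallyNull_of_map_eq_zero hR ?_
    rw [map_amplitude, ← amplitude_solutionGen_eq_zero A b i j y z hV]
    congr 1
    ext1 o
    simp [solutionGen, PresentedGroup.of]
  have hev : ∀ᶠ k in atTop, δ / 2 ≤
      normalizedFrobenius ((φ k J : Matrix (Fin (d k)) (Fin (d k)) ℂ) - 1) := by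
    filter_upwards [(tendsto_order.1 hwJ).2 (δ / 2) (by positivity)] with k hk
    have h1 := normalizedFrobenius_add_le
      ((φ k w : Matrix (Fin (d k)) (Fin (d k)) ℂ) - (φ k J : Matrix (Fin (d k)) (Fin (d k)) ℂ))
      ((φ k J : Matrix (Fin (d k)) (Fin (d k)) ℂ) - 1)
    rw [map_sub, groupAlgebraRep_of, groupAlgebraRep_of] at hk
    rw [sub_add_sub_cancel] at h1
    linarith [hφw k]
  -- The denominator `‖φ J - 1‖ / 2` is replaced by its eventual lower bound `δ / 4`, leaving an
  -- upper bound for the loss that tends to 0.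
  let loss : ℕ → ℝ := fun k => ∑ i : Fin m, ∑ j : Fin n, 1 / ((m : ℝ) * (n : ℝ)) *
    ∑ y, ∑ z, (if IsWinning A b i j y z then 0 else 1) *
      (normalizedFrobenius (groupAlgebraRep (φ k)
        (amplitude A (fun o => MonoidAlgebra.of ℂ _ (FreeGroup.of o)) i j y z)) / (δ / 4)) ^ 2
  have hloss : Tendsto loss atTop (𝓝 0) := by
    have h0 : (0 : ℝ) = ∑ i : Fin m, ∑ j : Fin n, 1 / ((m : ℝ) * (n : ℝ)) *
      ∑ _y : {j // j ∈ eqnVars A i} → ZMod 2, ∑ _z : ZMod 2, 0 := by simp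
    rw [h0]
    refine tendsto_finsetSum _ fun i _ => tendsto_finsetSum _ fun j _ =>
      Tendsto.const_mul _ (tendsto_finsetSum _ fun y _ => tendsto_finsetSum _ fun z _ => ?_)
    by_cases hV : IsWinning A b i j y z
    · simp [hV]
    · simp only [hV, if_false, one_mul]
      have := ((hamp i j y z hV).div_const (δ / 4)).pow 2
      simpa using this
  have hle : ∀ᶠ k in atTop, 1 - loss k ≤ quantumValue (linearSystemGame A b) := by
    filter_upwards [hev] with k hk
    have hne : (φ k J : Matrix (Fin (d k)) (Fin (d k)) ℂ) ≠ 1 := by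
      intro h0
      rw [h0, sub_self] at hk
      simp only [normalizedFrobenius_eq, norm_zero, zero_div] at hk
      linarith
    obtain ⟨S, hS⟩ := exists_strategy_of_rep A b (hd k) (φ k) hne
    refine le_trans ?_ S.winProb_le_quantumValue
    rw [winProb_linearSystemGame]
    refine sub_le_sub_left (Finset.sum_le_sum fun i _ => Finset.sum_le_sum fun j _ =>
      mul_le_mul_of_nonneg_left (Finset.sum_le_sum fun y _ => Finset.sum_le_sum fun z _ => ?_)
        (by positivity)) _
    rw [hS]
    have hn := normalizedFrobenius_nonneg (groupAlgebraRep (φ k)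
        (amplitude A (fun o => MonoidAlgebra.of ℂ _ (FreeGroup.of o)) i j y z))
    split_ifs
    · simp
    · rw [one_mul, one_mul]
      have hJ : δ / 4 ≤ normalizedFrobenius ((φ k J : Matrix (Fin (d k)) (Fin (d k)) ℂ) - 1) / 2 := by
        linarith
      have h4 : 0 < δ / 4 := by positivity
      exact pow_le_pow_left₀ (div_nonneg hn (h4.le.trans hJ))
        (div_le_div_of_nonneg_left hn h4 hJ) 2
  have := hloss.const_sub 1
  rw [sub_zero] at this
  exact le_of_tendsto this hle

end ApproxRepToStrategy

/-! ### Choosing a level set by integration over thresholds. -/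

section Threshold

open MeasureTheory

/-- Layer cake: the left side of `h` is the integral over `u` of the left side of the conclusion for
`S = {t : u < l t}`. Were that positive for every nonempty `S`, the integrand `f` would be
nonnegative, and positive on some `[0, l t₀)`, so its integral would be positive. -/
theorem exists_threshold_set {ι : Type*} [Fintype ι] [DecidableEq ι] [Nonempty ι] (l w : ι → ℝ)
    (c : ι → ι → ℝ) (hl : ∀ t, 0 < l t)
    (h : ∑ t, l t * w t + ∑ t, ∑ s, c s t * max (l t - l s) 0 ≤ 0) :
    ∃ S : Finset ι, S.Nonempty ∧ ∑ t ∈ S, w t + ∑ t ∈ S, ∑ s ∈ Sᶜ, c s t ≤ 0 := by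
  by_contra! hS
  let f : ℝ → ℝ := fun u => ∑ t, w t * (Set.Ico 0 (l t)).indicator 1 u +
    ∑ t, ∑ s, c s t * (Set.Ico (l s) (l t)).indicator 1 u
  have hint : ∀ a b : ℝ, Integrable ((Set.Ico a b).indicator (1 : ℝ → ℝ)) := fun a b =>
    (integrable_indicator_iff measurableSet_Ico).2
      (integrableOn_const (by simp [Real.volume_Ico]))
  have hval : ∀ a b : ℝ, ∫ u, (Set.Ico a b).indicator (1 : ℝ → ℝ) u = max (b - a) 0 := by
    intro a b
    rw [integral_indicator_one measurableSet_Ico, Real.volume_real_Ico]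
  have hfi : Integrable f := by
    refine (integrable_finsetSum _ fun t _ => (hint _ _).const_mul _).add
      (integrable_finsetSum _ fun t _ => integrable_finsetSum _ fun s _ => (hint _ _).const_mul _)
  have hf : ∫ u, f u ≤ 0 := by
    refine le_of_eq_of_le ?_ h
    rw [integral_add (integrable_finsetSum _ fun t _ => (hint _ _).const_mul _)
      (integrable_finsetSum _ fun t _ => integrable_finsetSum _ fun s _ => (hint _ _).const_mul _),
      integral_finsetSum _ fun t _ => (hint _ _).const_mul _,
      integral_finsetSum _ fun t _ => integrable_finsetSum _ fun s _ => (hint _ _).const_mul _]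
    congr 1
    · refine Finset.sum_congr rfl fun t _ => ?_
      rw [integral_const_mul, hval, sub_zero, max_eq_left (hl t).le, mul_comm]
    · refine Finset.sum_congr rfl fun t _ => ?_
      rw [integral_finsetSum _ fun s _ => (hint _ _).const_mul _]
      refine Finset.sum_congr rfl fun s _ => ?_
      rw [integral_const_mul, hval]
  have hfS : ∀ u, 0 ≤ u → f u = ∑ t ∈ Finset.univ.filter (u < l ·), w t +
      ∑ t ∈ Finset.univ.filter (u < l ·), ∑ s ∈ (Finset.univ.filter (u < l ·))ᶜ, c s t := by
    intro u hu
    simp only [f, Finset.sum_filter, Set.indicator_apply, Set.mem_Ico, hu, true_and, Pi.one_apply,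
      Finset.compl_filter, mul_ite, mul_one, mul_zero, not_lt]
    congr 1
    refine Finset.sum_congr rfl fun t _ => ?_
    split_ifs with h1 <;> simp [h1]
  have hfpos : ∀ u, 0 ≤ f u := by
    intro u
    rcases le_or_gt 0 u with hu | hu
    · rw [hfS u hu]
      rcases (Finset.univ.filter (u < l ·)).eq_empty_or_nonempty with h0 | h0
      · simp [h0]
      · exact (hS _ h0).le
    · have h1 : ∀ a b : ℝ, 0 ≤ a → (Set.Ico a b).indicator (1 : ℝ → ℝ) u = 0 := fun a b ha =>
        Set.indicator_of_notMem (fun h => by linarith [h.1]) _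
      simp [f, h1, (hl _).le]
  obtain ⟨t₀⟩ := ‹Nonempty ι›
  have : 0 < ∫ u, f u := by
    rw [integral_pos_iff_support_of_nonneg hfpos hfi]
    refine lt_of_lt_of_le ?_ (measure_mono (s := Set.Ico 0 (l t₀)) fun u hu => ?_)
    · simp [Real.volume_Ico, hl t₀]
    · rw [Function.mem_support, hfS u hu.1]
      exact (hS _ ⟨t₀, by simpa using hu.2⟩).ne'
  linarith

end Threshold

/-! ### Rounding a compressed contraction to an involution. -/

section Rounding

variable {p q : Type*} [Fintype p] [Fintype q] [DecidableEq p] [DecidableEq q]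

theorem Matrix.IsHermitian.exists_unitary_diagonal {C : Matrix q q ℂ} (hC : C.IsHermitian) :
    ∃ (W : Matrix q q ℂ) (c : q → ℝ), Wᴴ * W = 1 ∧ W * Wᴴ = 1 ∧
      C = W * Matrix.diagonal (fun i => (c i : ℂ)) * Wᴴ := by
  refine ⟨hC.eigenvectorUnitary, hC.eigenvalues, Unitary.star_mul_self_of_mem hC.eigenvectorUnitary.2,
    Unitary.mul_star_self_of_mem hC.eigenvectorUnitary.2, ?_⟩
  have := hC.spectral_theorem
  rw [Unitary.conjStarAlgAut_apply] at this
  exact this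

theorem conj_mul_conj {W : Matrix q q ℂ} (hW : Wᴴ * W = 1) (M N : Matrix q q ℂ) :
    (W * M * Wᴴ) * (W * N * Wᴴ) = W * (M * N) * Wᴴ := by
  calc (W * M * Wᴴ) * (W * N * Wᴴ) = W * M * (Wᴴ * W) * N * Wᴴ := by
        simp only [Matrix.mul_assoc]
    _ = _ := by rw [hW]; simp only [Matrix.mul_assoc, Matrix.one_mul]

theorem trace_conj {W : Matrix q q ℂ} (hW : Wᴴ * W = 1) (M : Matrix q q ℂ) :
    (W * M * Wᴴ).trace = M.trace := by
  rw [Matrix.trace_mul_comm, ← Matrix.mul_assoc, hW, Matrix.one_mul]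

/-- `U` is the sign of the compression `C = Vᴴ B V`. Expanding the norms, the inequality reduces to
`Tr C² ≤ Tr (C U) = Tr |C|`, which holds since `C` is a contraction. -/
theorem exists_involution_intertwining {B : Matrix p p ℂ} (hB : B.IsHermitian)
    (hB1 : (1 - B * B).PosSemidef) {V : Matrix p q ℂ} (hV : Vᴴ * V = 1) :
    ∃ U : Matrix q q ℂ, U.IsHermitian ∧ U * U = 1 ∧
      ‖B * V - V * U‖ ^ 2 ≤ (Fintype.card q - ‖B * V‖ ^ 2) +
        2 * ‖B * V - V * (Vᴴ * B * V)‖ ^ 2 := by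
  set C := Vᴴ * B * V with hCdef
  have hC : C.IsHermitian := by
    rw [hCdef, Matrix.IsHermitian, Matrix.conjTranspose_mul, Matrix.conjTranspose_mul, hB.eq,
      Matrix.conjTranspose_conjTranspose, Matrix.mul_assoc]
  obtain ⟨W, c, hW, hW', hCW⟩ := hC.exists_unitary_diagonal
  have hC1 : (1 - C * C).PosSemidef := by
    have e : 1 - C * C = Vᴴ * (1 - B * B) * V +
        (B * V - V * C)ᴴ * (B * V - V * C) := by
      rw [Matrix.conjTranspose_sub, Matrix.conjTranspose_mul, Matrix.conjTranspose_mul, hB.eq,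
        hC.eq, Matrix.sub_mul, Matrix.mul_sub, Matrix.mul_sub, Matrix.mul_sub, Matrix.sub_mul]
      have e1 : Vᴴ * B * (V * C) = C * C := by rw [← Matrix.mul_assoc]
      have e2 : C * Vᴴ * (B * V) = C * C := by
        rw [Matrix.mul_assoc, ← Matrix.mul_assoc Vᴴ]
      have e3 : C * Vᴴ * (V * C) = C * C := by
        rw [Matrix.mul_assoc, ← Matrix.mul_assoc Vᴴ, hV, Matrix.one_mul]
      have e4 : Vᴴ * (B * B) * V = Vᴴ * B * (B * V) := by simp only [Matrix.mul_assoc]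
      rw [e1, e2, e3, e4, Matrix.mul_one, hV]
      abel
    rw [e]
    exact (hB1.conjTranspose_mul_mul_same V).add (Matrix.posSemidef_conjTranspose_mul_self _)
  have hc : ∀ i, c i ^ 2 ≤ 1 := by
    intro i
    have h1 := hC1.conjTranspose_mul_mul_same W
    have e : Wᴴ * (1 - C * C) * W = Matrix.diagonal (fun i => (1 - c i ^ 2 : ℂ)) := by
      have e0 : Wᴴ * (C * C) * W = (Wᴴ * W) * (Matrix.diagonal (fun i => (c i : ℂ)) *
          Matrix.diagonal (fun i => (c i : ℂ))) * (Wᴴ * W) := by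
        rw [hCW, conj_mul_conj hW]; simp only [Matrix.mul_assoc]
      rw [Matrix.mul_sub, Matrix.sub_mul, e0, hW, Matrix.mul_one, hW, Matrix.one_mul,
        Matrix.mul_one, Matrix.diagonal_mul_diagonal, ← Matrix.diagonal_one,
        Matrix.diagonal_sub]
      simp [sq]
    rw [e] at h1
    have h2 := h1.diag_nonneg (i := i)
    rw [Matrix.diagonal_apply_eq] at h2
    have h3 := (Complex.nonneg_iff.1 h2).1
    have : ((1 : ℂ) - (c i : ℂ) ^ 2).re = 1 - c i ^ 2 := by
      rw [← Complex.ofReal_pow, Complex.sub_re, Complex.ofReal_re, Complex.one_re]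
    linarith
  -- The value at 0 must be `±1`, not 0, so that `U² = 1`.
  let σ : q → ℝ := fun i => if 0 ≤ c i then 1 else -1
  have hσ : ∀ i, σ i * σ i = 1 := fun i => by simp only [σ]; split_ifs <;> norm_num
  have hcσ : ∀ i, c i ^ 2 ≤ c i * σ i := fun i => by
    have h1 := abs_le_one_iff_mul_self_le_one.2 (by nlinarith [hc i] : c i * c i ≤ 1)
    have : c i * σ i = |c i| := by
      simp only [σ]; split_ifs with h0
      · rw [abs_of_nonneg h0, mul_one]
      · rw [abs_of_neg (not_le.1 h0), mul_neg_one]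
    rw [this, ← sq_abs]
    nlinarith [abs_nonneg (c i)]
  set U := W * Matrix.diagonal (fun i => (σ i : ℂ)) * Wᴴ with hU
  have hUh : U.IsHermitian := by
    rw [Matrix.IsHermitian, hU, Matrix.conjTranspose_mul, Matrix.conjTranspose_mul,
      diagonal_ofReal_conjTranspose, Matrix.conjTranspose_conjTranspose, Matrix.mul_assoc]
  have hUU : U * U = 1 := by
    have e : (fun i => (σ i : ℂ) * (σ i : ℂ)) = fun _ => 1 := by
      ext i; exact_mod_cast hσ i
    rw [hU, conj_mul_conj hW, Matrix.diagonal_mul_diagonal, e, Matrix.diagonal_one, Matrix.mul_one,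
      hW']
  refine ⟨U, hUh, hUU, ?_⟩
  have hCU : (C * U).trace.re = ∑ i, c i * σ i := by
    rw [hCW, hU, conj_mul_conj hW, trace_conj hW, Matrix.diagonal_mul_diagonal,
      Matrix.trace_diagonal, Complex.re_sum]
    simp
  have hCC : (C * C).trace.re = ∑ i, c i ^ 2 := by
    rw [hCW, conj_mul_conj hW, trace_conj hW, Matrix.diagonal_mul_diagonal,
      Matrix.trace_diagonal, Complex.re_sum]
    simp [sq]
  have hBV : ∀ M : Matrix q q ℂ, (B * V)ᴴ * (V * M) = C * M := by
    intro M
    rw [Matrix.conjTranspose_mul, hB.eq, ← Matrix.mul_assoc]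
  have hCn : ‖C‖ ^ 2 = ∑ i, c i ^ 2 := by rw [frobenius_sq_eq_trace, hC.eq, hCC]
  have hUn : ‖U‖ ^ 2 = Fintype.card q := by
    rw [frobenius_sq_eq_trace, hUh.eq, hUU]; simp
  rw [frobenius_sub_sq, frobenius_sub_sq, hBV, hBV, frobenius_isometry_mul hV,
    frobenius_isometry_mul hV, hCU, hCC, hCn, hUn]
  have := Finset.sum_le_sum fun i (_ : i ∈ Finset.univ) => hcσ i
  linarith

/-- Letters are moved through `V` one at a time. Errors simply add up, since what stands to the left
of an error is a contraction and what stands to its right preserves the norm. -/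
theorem frobenius_list_prod_intertwining {α : Type*} (L : List α) {B : α → Matrix p p ℂ}
    {U : α → Matrix q q ℂ} (V : Matrix p q ℂ)
    (hB : ∀ a ∈ L, ∀ X : Matrix p q ℂ, ‖B a * X‖ ≤ ‖X‖)
    (hU : ∀ a ∈ L, ∀ X : Matrix p q ℂ, ‖X * U a‖ = ‖X‖) :
    ‖(L.map B).prod * V - V * (L.map U).prod‖ ≤ (L.map fun a => ‖B a * V - V * U a‖).sum := by
  have hUL : ∀ L' : List α, L' ⊆ L → ∀ X : Matrix p q ℂ, ‖X * (L'.map U).prod‖ = ‖X‖ := by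
    intro L'
    induction L' with
    | nil => simp
    | cons a L' ih =>
      intro hL X
      rw [List.map_cons, List.prod_cons, ← Matrix.mul_assoc,
        ih (fun x hx => hL (List.mem_cons_of_mem _ hx)), hU a (hL List.mem_cons_self)]
  induction L with
  | nil => simp
  | cons a L ih =>
    have ih' := ih (fun x hx => hB x (List.mem_cons_of_mem _ hx))
      (fun x hx => hU x (List.mem_cons_of_mem _ hx))
      (fun L' hL' => hUL L' fun x hx => List.mem_cons_of_mem _ (hL' hx))
    simp only [List.map_cons, List.prod_cons, List.sum_cons]
    have e : B a * (L.map B).prod * V - V * (U a * (L.map U).prod) =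
        (B a * V - V * U a) * (L.map U).prod +
        B a * ((L.map B).prod * V - V * (L.map U).prod) := by
      rw [Matrix.sub_mul, Matrix.mul_sub]
      simp only [Matrix.mul_assoc]
      abel
    rw [e]
    refine (norm_add_le _ _).trans (add_le_add ?_ ?_)
    · rw [hUL L fun x hx => List.mem_cons_of_mem _ hx]
    · exact (hB a List.mem_cons_self _).trans ih'

end Rounding

/-! ### Passing from Schmidt weights to uniform weights. -/

section Flattening

variable {ι : Type*} [Fintype ι] [DecidableEq ι]

theorem frobenius_mul_diagonal_sq (M : Matrix ι ι ℂ) (c : ι → ℝ) :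
    ‖M * Matrix.diagonal (fun i => (c i : ℂ))‖ ^ 2 = ∑ t, c t ^ 2 * ∑ s, ‖M s t‖ ^ 2 := by
  rw [frobenius_sq_eq_sum, Finset.sum_comm]
  refine Finset.sum_congr rfl fun t _ => ?_
  rw [Finset.mul_sum]
  refine Finset.sum_congr rfl fun s _ => ?_
  rw [Matrix.mul_diagonal, norm_mul, mul_pow, Complex.norm_real, Real.norm_eq_abs, sq_abs, mul_comm]

/-- From a Schmidt-weighted estimate to an estimate with uniform weights: the weight `D` is replaced
by an isometry `V` onto the span of some of the basis vectors, and hermitian contractions by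
self-adjoint unitaries which are almost intertwined by `V`. -/
theorem exists_isometry_involutions {τ κ : Type*} [Fintype κ] (c : ι → ℝ) (hc : ∀ i, 0 < c i)
    (hc1 : ∑ i, c i ^ 2 = 1) (T : Finset τ) (B : τ → Matrix ι ι ℂ) (hB : ∀ j, (B j).IsHermitian)
    (hB1 : ∀ j, (1 - B j * B j).PosSemidef) (X : κ → Matrix ι ι ℂ) (θ : ℝ)
    (h : ∑ j ∈ T, (2 * (∑ t, ∑ s, ‖B j s t‖ ^ 2 * |c t ^ 2 - c s ^ 2|) +
        (1 - ‖B j * Matrix.diagonal (fun i => (c i : ℂ))‖ ^ 2)) +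
      ∑ k, ‖X k * Matrix.diagonal (fun i => (c i : ℂ))‖ ^ 2 ≤ θ) :
    ∃ (d : ℕ) (V : Matrix ι (Fin d) ℂ) (U : τ → Matrix (Fin d) (Fin d) ℂ), 0 < d ∧ Vᴴ * V = 1 ∧
      (∀ j, (U j).IsHermitian) ∧ (∀ j, U j * U j = 1) ∧
      (∀ j ∈ T, ‖B j * V - V * U j‖ ^ 2 ≤ θ * d) ∧ ∀ k, ‖X k * V‖ ^ 2 ≤ θ * d := by
  have hne : Nonempty ι := by
    by_contra h0
    rw [not_nonempty_iff] at h0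
    simp at hc1
  -- As `∑ c² = 1`, the bound `θ` can be spread over the indices as `-θ`. The factor 2 in `e` is the
  -- one in `exists_involution_intertwining`; the off-block entries weighted by `e` will measure how
  -- far `B j` is from preserving the span of `S`.
  let w : ι → ℝ := fun t => ∑ j ∈ T, (1 - ∑ s, ‖B j s t‖ ^ 2) + ∑ k, ∑ s, ‖X k s t‖ ^ 2 - θ
  let e : ι → ι → ℝ := fun s t => 2 * ∑ j ∈ T, ‖B j s t‖ ^ 2
  have hthr : ∑ t, c t ^ 2 * w t + ∑ t, ∑ s, e s t * max (c t ^ 2 - c s ^ 2) 0 ≤ 0 := by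
    have h1 : ∑ t, c t ^ 2 * w t =
        ∑ j ∈ T, (1 - ‖B j * Matrix.diagonal (fun i => (c i : ℂ))‖ ^ 2) +
        ∑ k, ‖X k * Matrix.diagonal (fun i => (c i : ℂ))‖ ^ 2 - θ := by
      simp only [w, mul_sub, mul_add, Finset.sum_sub_distrib, Finset.sum_add_distrib,
        frobenius_mul_diagonal_sq, Finset.mul_sum (Finset.univ : Finset κ),
        Finset.mul_sum T, ← Finset.sum_mul, hc1, one_mul]
      rw [Finset.sum_comm (t := (Finset.univ : Finset κ)), Finset.sum_comm (t := T),
        Finset.sum_comm (t := T)]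
      simp only [mul_one, hc1]
    have h2 : ∑ t, ∑ s, e s t * max (c t ^ 2 - c s ^ 2) 0 ≤
        ∑ j ∈ T, 2 * (∑ t, ∑ s, ‖B j s t‖ ^ 2 * |c t ^ 2 - c s ^ 2|) := by
      simp only [e, Finset.mul_sum, Finset.sum_mul]
      rw [Finset.sum_comm (s := T)]
      refine Finset.sum_le_sum fun t _ => ?_
      rw [Finset.sum_comm (s := T)]
      refine Finset.sum_le_sum fun s _ => Finset.sum_le_sum fun j _ => ?_
      rw [mul_assoc]
      have : max (c t ^ 2 - c s ^ 2) 0 ≤ |c t ^ 2 - c s ^ 2| := max_le (le_abs_self _) (abs_nonneg _)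
      gcongr
    rw [Finset.sum_add_distrib] at h
    linarith
  obtain ⟨S, hS, hle⟩ := exists_threshold_set (fun t => c t ^ 2) w e
    (fun t => pow_pos (hc t) 2) hthr
  let g : Fin S.card → ι := fun a => (S.equivFin.symm a : ι)
  have hg : Function.Injective g := Subtype.val_injective.comp S.equivFin.symm.injective
  have hgS : ∀ a, g a ∈ S := fun a => (S.equivFin.symm a).2
  have hsum : ∀ f : ι → ℝ, ∑ a, f (g a) = ∑ t ∈ S, f t := fun f => by
    rw [← Finset.sum_coe_sort S f]
    exact S.equivFin.symm.sum_comp fun t => f t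
  -- `V` is the inclusion of the coordinates in `S`. Then `M * V` keeps the columns in `S`, and
  -- subtracting `V * (Vᴴ * M * V)` leaves only the rows outside `S`.
  let V : Matrix ι (Fin S.card) ℂ := (1 : Matrix ι ι ℂ).submatrix id g
  have hMV : ∀ M : Matrix ι ι ℂ, M * V = M.submatrix id g := fun M => by
    ext s a; simp [V, Matrix.mul_apply, Matrix.one_apply]
  have hVM : ∀ (M : Matrix ι (Fin S.card) ℂ), Vᴴ * M = M.submatrix g id := fun M => by
    ext s a; simp [V, Matrix.mul_apply, Matrix.one_apply]
  have hV : Vᴴ * V = 1 := by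
    rw [hVM]; ext s t; simp [V, Matrix.one_apply, hg.eq_iff]
  have hnorm : ∀ M : Matrix ι ι ℂ, ‖M * V‖ ^ 2 = ∑ t ∈ S, ∑ s, ‖M s t‖ ^ 2 := fun M => by
    rw [hMV, frobenius_sq_eq_sum, Finset.sum_comm, ← hsum]
    rfl
  have hker : ∀ M : Matrix ι ι ℂ, ‖M * V - V * (Vᴴ * M * V)‖ ^ 2 =
      ∑ t ∈ S, ∑ s ∈ Sᶜ, ‖M s t‖ ^ 2 := fun M => by
    rw [frobenius_sq_eq_sum, Finset.sum_comm, ← hsum]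
    refine Finset.sum_congr rfl fun a _ => ?_
    rw [← Finset.sum_compl_add_sum S]
    have h0 : ∀ s ∈ S, ‖(M * V - V * (Vᴴ * M * V)) s a‖ ^ 2 = 0 := by
      intro s hs
      obtain ⟨a', rfl⟩ : ∃ a', g a' = s := ⟨S.equivFin ⟨s, hs⟩, by simp [g]⟩
      rw [Matrix.mul_assoc Vᴴ, hVM, hMV, Matrix.sub_apply, Matrix.mul_apply]
      simp [V, Matrix.one_apply, hg.eq_iff]
    have h1 : ∀ s ∈ Sᶜ, ‖(M * V - V * (Vᴴ * M * V)) s a‖ ^ 2 = ‖M s (g a)‖ ^ 2 := by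
      intro s hs
      have hs' : ∀ a', s ≠ g a' := fun a' h => (Finset.mem_compl.1 hs) (h ▸ hgS a')
      rw [Matrix.sub_apply, hMV M, Matrix.mul_apply]
      simp [V, hs']
    rw [Finset.sum_eq_zero h0, add_zero, Finset.sum_congr rfl h1]
  choose U hUh hUU hU using fun j => exists_involution_intertwining (hB j) (hB1 j) hV
  have hle' : ∑ j ∈ T, ((S.card - ‖B j * V‖ ^ 2) + 2 * ‖B j * V - V * (Vᴴ * B j * V)‖ ^ 2) +
      ∑ k, ‖X k * V‖ ^ 2 ≤ θ * S.card := by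
    have h1 : ∑ t ∈ S, w t = ∑ j ∈ T, (S.card - ‖B j * V‖ ^ 2) + ∑ k, ‖X k * V‖ ^ 2 -
        θ * S.card := by
      simp only [w, Finset.sum_sub_distrib, Finset.sum_add_distrib, hnorm]
      rw [Finset.sum_comm (t := (Finset.univ : Finset κ)), Finset.sum_comm (t := T)]
      rw [Finset.sum_comm (s := S) (t := T) (f := fun t j => ∑ s, ‖B j s t‖ ^ 2)]
      simp [mul_comm]
    have h2 : ∑ t ∈ S, ∑ s ∈ Sᶜ, e s t =
        ∑ j ∈ T, 2 * ‖B j * V - V * (Vᴴ * B j * V)‖ ^ 2 := by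
      simp only [hker, e, Finset.mul_sum]
      rw [Finset.sum_comm (s := T)]
      refine Finset.sum_congr rfl fun t _ => ?_
      rw [Finset.sum_comm]
    rw [h1, h2] at hle
    rw [Finset.sum_add_distrib]
    linarith
  -- Each summand dominates a squared norm and is therefore nonnegative, so the bound on the sum
  -- holds for each term.
  have hnn : ∀ j, 0 ≤ ((S.card - ‖B j * V‖ ^ 2) + 2 * ‖B j * V - V * (Vᴴ * B j * V)‖ ^ 2) := by
    intro j
    have := hU j
    rw [Fintype.card_fin] at this
    exact (sq_nonneg _).trans this
  refine ⟨S.card, V, U, hS.card_pos, hV, hUh, hUU, fun j hj => ?_, fun k => ?_⟩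
  · have h1 := hU j
    rw [Fintype.card_fin] at h1
    have h2 := Finset.single_le_sum (fun j _ => hnn j) hj
    have h3 : 0 ≤ ∑ k, ‖X k * V‖ ^ 2 := Finset.sum_nonneg fun _ _ => sq_nonneg _
    linarith
  · have h2 := Finset.single_le_sum (f := fun k => ‖X k * V‖ ^ 2) (fun _ _ => sq_nonneg _)
      (Finset.mem_univ k)
    have h3 := Finset.sum_nonneg fun j (_ : j ∈ T) => hnn j
    linarith

end Flattening

/-! ### Two-outcome measurements and their observables. -/

section Observable

variable {p q : Type*} [Fintype p] [Fintype q] [DecidableEq p]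

/-- `P - P² = P Q` is positive semidefinite. -/
theorem frobenius_sq_mul_le_of_add_eq_one {P Q : Matrix p p ℂ} (hP : P.PosSemidef)
    (hQ : Q.PosSemidef) (h : P + Q = 1) (V : Matrix p q ℂ) :
    ‖P * V‖ ^ 2 ≤ (Vᴴ * P * V).trace.re := by
  have h1 := ((hP.mul_of_add_eq_one hQ h).conjTranspose_mul_mul_same V).trace_re_nonneg
  have e : Vᴴ * (P * Q) * V = Vᴴ * P * V - (P * V)ᴴ * (P * V) := by
    rw [← eq_sub_iff_add_eq'] at h
    rw [h, Matrix.conjTranspose_mul, hP.isHermitian.eq, Matrix.mul_sub, Matrix.mul_one,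
      Matrix.mul_sub, Matrix.sub_mul]
    simp only [Matrix.mul_assoc]
  rw [e, Matrix.trace_sub, Complex.sub_re, ← frobenius_sq_eq_trace] at h1
  linarith

theorem frobenius_sq_sub_sq_observable {P Q : Matrix p p ℂ}
    (h : P + Q = 1) (V : Matrix p q ℂ) :
    ‖V‖ ^ 2 - ‖(Q - P) * V‖ ^ 2 = 4 * ((Vᴴ * P * V).trace.re - ‖P * V‖ ^ 2) := by
  have e : (Q - P) * V = V - (2 : ℂ) • (P * V) := by
    rw [← eq_sub_iff_add_eq'] at h
    rw [h, Matrix.sub_mul, Matrix.sub_mul, Matrix.one_mul]; module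
  rw [e, frobenius_sub_sq, norm_smul, Matrix.mul_smul, Matrix.trace_smul, ← Matrix.mul_assoc,
    smul_eq_mul]
  have : ((2 : ℂ) * (Vᴴ * P * V).trace).re = 2 * (Vᴴ * P * V).trace.re := by
    simp
  rw [this]
  norm_num
  ring

end Observable

/-! ### Bob's observables in a nearly perfect strategy. -/

section NearPerfect

variable {m n : ℕ}

/-- The operators of a strategy for the linear system game in Schmidt form, in which every pair of
questions is lost with probability at most `μ`. -/
structure IsNearPerfect (A : Matrix (Fin m) (Fin n) (ZMod 2)) (b : Fin m → ZMod 2)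
    {ι : Type*} [Fintype ι] [DecidableEq ι] (D : Matrix ι ι ℂ)
    (MA : (i : Fin m) → ({j // j ∈ eqnVars A i} → ZMod 2) → Matrix ι ι ℂ)
    (MB : Fin n → ZMod 2 → Matrix ι ι ℂ) (μ : ℝ) : Prop where
  isHermitian : D.IsHermitian
  norm_eq_one : ‖D‖ = 1
  posA : ∀ i y, (MA i y).PosSemidef
  sumA : ∀ i, ∑ y, MA i y = 1
  posB : ∀ j z, (MB j z).PosSemidef
  sumB : ∀ j, ∑ z, MB j z = 1
  loss : ∀ i j (s : Finset (({j // j ∈ eqnVars A i} → ZMod 2) × ZMod 2)),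
    (∀ r ∈ s, ¬ IsWinning A b i j r.1 r.2) →
      ∑ r ∈ s, (D * MA i r.1 * D * MB j r.2).trace.re ≤ μ

/-- Bob's observable. -/
def bobObs {ι : Type*} (MB : Fin n → ZMod 2 → Matrix ι ι ℂ) (j : Fin n) : Matrix ι ι ℂ :=
  MB j 0 - MB j 1

namespace IsNearPerfect

variable {A : Matrix (Fin m) (Fin n) (ZMod 2)} {b : Fin m → ZMod 2}
  {ι : Type*} [Fintype ι] [DecidableEq ι] {D : Matrix ι ι ℂ}
  {MA : (i : Fin m) → ({j // j ∈ eqnVars A i} → ZMod 2) → Matrix ι ι ℂ}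
  {MB : Fin n → ZMod 2 → Matrix ι ι ℂ} {μ : ℝ}

theorem add_eq_one (h : IsNearPerfect A b D MA MB μ) (j : Fin n) (z : ZMod 2) :
    MB j (z + 1) + MB j z = 1 := by
  have h1 := h.sumB j
  rw [sum_zmod_two] at h1
  fin_cases z
  · rw [← h1, add_comm]; rfl
  · rw [← h1]; rfl

omit [Fintype ι] [DecidableEq ι] in
theorem bobObs_eq (MB : Fin n → ZMod 2 → Matrix ι ι ℂ) (j : Fin n) (z : ZMod 2) :
    bobObs MB j = parity z • (MB j z - MB j (z + 1)) := by
  fin_cases z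
  · change _ = parity 0 • (MB j 0 - MB j 1)
    rw [parity_zero, one_smul]; rfl
  · change _ = parity 1 • (MB j 1 - MB j 0)
    rw [parity_one, neg_one_smul, neg_sub]; rfl

theorem norm_parity (z : ZMod 2) : ‖parity z‖ = 1 := by simp [parity]

theorem isHermitian_bobObs (h : IsNearPerfect A b D MA MB μ) (j : Fin n) :
    (bobObs MB j).IsHermitian :=
  (h.posB j 0).isHermitian.sub (h.posB j 1).isHermitian

theorem posSemidef_one_sub_bobObs (h : IsNearPerfect A b D MA MB μ) (j : Fin n) :
    (1 - bobObs MB j * bobObs MB j).PosSemidef := by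
  have h1 := h.sumB j
  rw [sum_zmod_two] at h1
  have := (h.posB j 0).one_sub_sq (h.posB j 1) h1
  rwa [((h.posB j 0).isHermitian.sub (h.posB j 1).isHermitian).eq] at this

theorem bobObs_contraction (h : IsNearPerfect A b D MA MB μ) (j : Fin n) {q : Type*} [Fintype q]
    (X : Matrix ι q ℂ) : ‖bobObs MB j * X‖ ≤ ‖X‖ := by
  refine frobenius_contraction_mul ?_ X
  rw [(h.isHermitian_bobObs j).eq]
  exact h.posSemidef_one_sub_bobObs j

theorem norm_sq_bobObs_sub (h : IsNearPerfect A b D MA MB μ) (j : Fin n) (z : ZMod 2)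
    {q : Type*} [Fintype q] (V : Matrix ι q ℂ) :
    ‖bobObs MB j * V - parity z • V‖ ^ 2 ≤ 4 * (Vᴴ * MB j (z + 1) * V).trace.re := by
  have e : bobObs MB j * V - parity z • V = (-2 * parity z) • (MB j (z + 1) * V) := by
    have h1 := h.add_eq_one j z
    rw [← eq_sub_iff_add_eq'] at h1
    rw [bobObs_eq MB j z, h1, Matrix.smul_mul, Matrix.sub_mul, Matrix.sub_mul, Matrix.one_mul]
    module
  rw [e, norm_smul, norm_mul, norm_parity, mul_pow]
  norm_num
  exact frobenius_sq_mul_le_of_add_eq_one (h.posB j _) (h.posB j z) (h.add_eq_one j z) V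

theorem sq_sub_sq_bobObs (h : IsNearPerfect A b D MA MB μ) (j : Fin n) (z : ZMod 2)
    {q : Type*} [Fintype q] (V : Matrix ι q ℂ) :
    ‖V‖ ^ 2 - ‖bobObs MB j * V‖ ^ 2 ≤ 4 * (Vᴴ * MB j (z + 1) * V).trace.re := by
  rw [bobObs_eq MB j z, Matrix.smul_mul, norm_smul, norm_parity, one_mul,
    frobenius_sq_sub_sq_observable (h.add_eq_one j z)]
  nlinarith [sq_nonneg ‖MB j (z + 1) * V‖]

/-- `V y` plays the role of the unnormalised state after Alice's answer `y`. By `sum_norm_sq_mul`,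
estimates for all `V y` add up to an estimate for `D`. -/
theorem exists_factor (h : IsNearPerfect A b D MA MB μ) (i : Fin m) :
    ∃ V : ({j // j ∈ eqnVars A i} → ZMod 2) → Matrix ι ι ℂ,
      ∀ y, V y * (V y)ᴴ = D * MA i y * D := by
  choose R hR using fun y => (h.posA i y).exists_eq_conjTranspose_mul_self
  refine ⟨fun y => D * (R y)ᴴ, fun y => ?_⟩
  rw [Matrix.conjTranspose_mul, h.isHermitian.eq, Matrix.conjTranspose_conjTranspose, hR y]
  simp only [Matrix.mul_assoc]

omit [DecidableEq ι] in
theorem trace_conj_factor {V W M : Matrix ι ι ℂ} (hV : V * Vᴴ = W) :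
    (Vᴴ * M * V).trace.re = (W * M).trace.re := by
  rw [Matrix.mul_assoc, Matrix.trace_mul_comm, Matrix.mul_assoc, hV, Matrix.trace_mul_comm]

theorem sum_norm_sq_mul (h : IsNearPerfect A b D MA MB μ) {i : Fin m}
    {V : ({j // j ∈ eqnVars A i} → ZMod 2) → Matrix ι ι ℂ}
    (hV : ∀ y, V y * (V y)ᴴ = D * MA i y * D) (M : Matrix ι ι ℂ) :
    ∑ y, ‖M * V y‖ ^ 2 = ‖M * D‖ ^ 2 := by
  have h1 : ∀ N : Matrix ι ι ℂ, ‖M * N‖ ^ 2 = (Nᴴ * (Mᴴ * M) * N).trace.re := fun N => by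
    rw [frobenius_sq_eq_trace, Matrix.conjTranspose_mul]; simp only [Matrix.mul_assoc]
  have h2 : D * Dᴴ = D * (∑ y, MA i y) * D := by
    rw [h.sumA, Matrix.mul_one, h.isHermitian.eq]
  rw [h1, trace_conj_factor h2]
  simp only [h1, trace_conj_factor (hV _), ← Complex.re_sum, ← Matrix.trace_sum, ← Matrix.sum_mul,
    ← Matrix.mul_sum]

theorem sum_loss_le (h : IsNearPerfect A b D MA MB μ) {i : Fin m} {j : Fin n}
    (hj : j ∈ eqnVars A i) :
    ∑ y, (D * MA i y * D * MB j (y ⟨j, hj⟩ + 1)).trace.re ≤ μ := by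
  have := h.loss i j (Finset.univ.image fun y => (y, y ⟨j, hj⟩ + 1)) (by
    intro r hr hw
    obtain ⟨y, -, rfl⟩ := Finset.mem_image.1 hr
    have := hw.2 hj
    simp at this)
  rwa [Finset.sum_image (by intro y _ y' _ hyy; exact congrArg Prod.fst hyy)] at this

/-- Bob's question `j` is arbitrary: an answer of Alice that violates her equation loses against
anything, and Bob's effects sum to 1. -/
theorem sum_norm_sq_wrong_parity_le (h : IsNearPerfect A b D MA MB μ) (j : Fin n) {i : Fin m}
    {V : ({j // j ∈ eqnVars A i} → ZMod 2) → Matrix ι ι ℂ}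
    (hV : ∀ y, V y * (V y)ᴴ = D * MA i y * D) :
    ∑ y, (if ∑ k, y k = b i then 0 else ‖V y‖ ^ 2) ≤ μ := by
  have h1 := h.loss i j ((Finset.univ.filter fun y => ¬ ∑ k, y k = b i) ×ˢ Finset.univ) (by
    intro r hr hw
    exact (Finset.mem_filter.1 (Finset.mem_product.1 hr).1).2 hw.1)
  rw [Finset.sum_product] at h1
  refine le_trans (le_of_eq ?_) h1
  simp only [← ite_not (∑ k, _ = _)]
  rw [Finset.sum_filter]
  refine Finset.sum_congr rfl fun y _ => ?_
  split_ifs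
  · rfl
  · rw [← Complex.re_sum, ← Matrix.trace_sum, ← Matrix.mul_sum, h.sumB, Matrix.mul_one, ← hV,
      Matrix.trace_mul_comm, frobenius_sq_eq_trace]

theorem sum_norm_sq_bobObs_sub_le (h : IsNearPerfect A b D MA MB μ) {i : Fin m} {j : Fin n}
    (hj : j ∈ eqnVars A i) {V : ({j // j ∈ eqnVars A i} → ZMod 2) → Matrix ι ι ℂ}
    (hV : ∀ y, V y * (V y)ᴴ = D * MA i y * D) :
    ∑ y, ‖bobObs MB j * V y - parity (y ⟨j, hj⟩) • V y‖ ^ 2 ≤ 4 * μ := by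
  refine (Finset.sum_le_sum fun y _ => h.norm_sq_bobObs_sub j (y ⟨j, hj⟩) (V y)).trans ?_
  rw [← Finset.mul_sum]
  simp only [trace_conj_factor (hV _)]
  exact mul_le_mul_of_nonneg_left (h.sum_loss_le hj) (by norm_num)

theorem one_sub_norm_sq_bobObs_le (h : IsNearPerfect A b D MA MB μ) {i : Fin m} {j : Fin n}
    (hj : j ∈ eqnVars A i) : 1 - ‖bobObs MB j * D‖ ^ 2 ≤ 4 * μ := by
  obtain ⟨V, hV⟩ := h.exists_factor i
  have h1 := h.sum_norm_sq_mul hV 1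
  simp only [Matrix.one_mul, h.norm_eq_one, one_pow] at h1
  rw [← h1, ← h.sum_norm_sq_mul hV, ← Finset.sum_sub_distrib]
  refine (Finset.sum_le_sum fun y _ => h.sq_sub_sq_bobObs j (y ⟨j, hj⟩) (V y)).trans ?_
  rw [← Finset.mul_sum]
  simp only [trace_conj_factor (hV _)]
  exact mul_le_mul_of_nonneg_left (h.sum_loss_le hj) (by norm_num)

theorem list_prod_smul_one {α : Type*} (L : List α) (f : α → ℂ) :
    (L.map fun a => f a • (1 : Matrix ι ι ℂ)).prod = (L.map f).prod • (1 : Matrix ι ι ℂ) := by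
  induction L with
  | nil => simp
  | cons a L ih => simp [ih, smul_smul, mul_comm]

/-- Given Alice's answer `y`, each `B j` is close to the scalar `parity (y j)`, so a word is close
to a product of signs, whatever the order of its letters. This covers commutators as well as
equations. If `y` satisfies the equation that product is `s`; otherwise two scalars of modulus 1
differ by at most 2, on total weight at most `μ`. Squaring a sum of two errors costs a factor 2,
whence `2 · 4n` times the squared length, and `2 · 4`. -/
theorem norm_word_sub_le (h : IsNearPerfect A b D MA MB μ) [NeZero n] {i : Fin m}
    (L : List {j // j ∈ eqnVars A i}) {s : ℂ} (hs : ‖s‖ = 1)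
    (hL : ∀ y : {j // j ∈ eqnVars A i} → ZMod 2, ∑ k, y k = b i →
      (L.map fun j => parity (y j)).prod = s) :
    ‖((L.map fun j => bobObs MB j.1).prod - s • 1) * D‖ ^ 2 ≤
      (8 * n * (L.length : ℝ) ^ 2 + 8) * μ := by
  obtain ⟨V, hV⟩ := h.exists_factor i
  let T : ({j // j ∈ eqnVars A i} → ZMod 2) → ℝ := fun y =>
    ∑ j : {j // j ∈ eqnVars A i}, ‖bobObs MB j * V y - parity (y j) • V y‖ ^ 2
  have hT : ∑ y, T y ≤ n * (4 * μ) := by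
    have hμ : 0 ≤ 4 * μ := by
      have := h.loss i 0 ∅ (by simp)
      simpa using this
    simp only [T]
    rw [Finset.sum_comm]
    refine (Finset.sum_le_sum fun j _ => h.sum_norm_sq_bobObs_sub_le j.2 hV).trans ?_
    rw [Finset.sum_const, nsmul_eq_mul]
    refine mul_le_mul_of_nonneg_right ?_ hμ
    have : Fintype.card {j // j ∈ eqnVars A i} ≤ n :=
      (Fintype.card_subtype_le _).trans (Fintype.card_fin n).le
    exact_mod_cast this
  have hword : ∀ y, ‖((L.map fun j => bobObs MB j.1).prod - s • 1) * V y‖ ^ 2 ≤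
      2 * (L.length : ℝ) ^ 2 * T y + 8 * (if ∑ k, y k = b i then 0 else ‖V y‖ ^ 2) := by
    intro y
    have hT0 : 0 ≤ T y := Finset.sum_nonneg fun _ _ => sq_nonneg _
    have h1 := frobenius_list_prod_intertwining L (B := fun j => bobObs MB j.1)
      (U := fun j => parity (y j) • (1 : Matrix ι ι ℂ)) (V y)
      (fun j _ X => h.bobObs_contraction j X)
      (fun j _ X => by rw [Matrix.mul_smul, Matrix.mul_one, norm_smul, norm_parity, one_mul])
    rw [list_prod_smul_one, Matrix.mul_smul, Matrix.mul_one] at h1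
    have h2 : (L.map fun j => ‖bobObs MB j.1 * V y - V y * (parity (y j) • 1)‖).sum ≤
        L.length * √(T y) := by
      have := List.sum_le_card_nsmul (L.map fun j : {j // j ∈ eqnVars A i} =>
        ‖bobObs MB j * V y - V y * (parity (y j) • 1)‖) (√(T y)) (by
          intro x hx
          obtain ⟨j, -, rfl⟩ := List.mem_map.1 hx
          rw [Matrix.mul_smul, Matrix.mul_one]
          refine Real.le_sqrt_of_sq_le ?_
          exact Finset.single_le_sum (f := fun j : {j // j ∈ eqnVars A i} =>
            ‖bobObs MB j * V y - parity (y j) • V y‖ ^ 2) (fun _ _ => sq_nonneg _)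
            (Finset.mem_univ j))
      simpa using this
    have h3 : ‖(L.map fun j => parity (y j)).prod • V y - s • V y‖ ^ 2 ≤
        4 * (if ∑ k, y k = b i then 0 else ‖V y‖ ^ 2) := by
      split_ifs with hy
      · rw [hL y hy, sub_self]; simp
      · have hp : ‖(L.map fun j => parity (y j)).prod‖ = 1 := by
          clear h1 h2 hL
          induction L with
          | nil => simp
          | cons a L ih => simp [norm_parity, ih]
        have h4 := norm_sub_le ((L.map fun j => parity (y j)).prod • V y) (s • V y)
        rw [norm_smul, norm_smul, hp, hs, one_mul] at h4
        nlinarith [norm_nonneg ((L.map fun j => parity (y j)).prod • V y - s • V y)]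
    have e : ((L.map fun j => bobObs MB j.1).prod - s • 1) * V y =
        ((L.map fun j => bobObs MB j.1).prod * V y - (L.map fun j => parity (y j)).prod • V y) +
        ((L.map fun j => parity (y j)).prod • V y - s • V y) := by
      rw [Matrix.sub_mul, Matrix.smul_mul, Matrix.one_mul]; abel
    rw [e]
    set X := (L.map fun j => bobObs MB j.1).prod * V y -
      (L.map fun j => parity (y j)).prod • V y
    set Y := (L.map fun j => parity (y j)).prod • V y - s • V y
    have h5 : ‖X‖ ^ 2 ≤ (L.length : ℝ) ^ 2 * T y := by
      calc ‖X‖ ^ 2 ≤ (L.length * √(T y)) ^ 2 :=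
            pow_le_pow_left₀ (norm_nonneg _) (h1.trans h2) 2
        _ = _ := by rw [mul_pow, Real.sq_sqrt hT0]
    have h6 : ‖X + Y‖ ^ 2 ≤ 2 * ‖X‖ ^ 2 + 2 * ‖Y‖ ^ 2 := by
      have := pow_le_pow_left₀ (norm_nonneg _) (norm_add_le X Y) 2
      nlinarith [sq_nonneg (‖X‖ - ‖Y‖)]
    linarith
  rw [← h.sum_norm_sq_mul hV]
  refine (Finset.sum_le_sum fun y _ => hword y).trans ?_
  rw [Finset.sum_add_distrib, ← Finset.mul_sum, ← Finset.mul_sum]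
  have h7 := h.sum_norm_sq_wrong_parity_le 0 hV
  have h8 := mul_le_mul_of_nonneg_left hT (by positivity : 0 ≤ 2 * (L.length : ℝ) ^ 2)
  nlinarith

end IsNearPerfect

end NearPerfect

/-! ### Bob's observables almost commute with the squared Schmidt weights. -/

section Commutator

theorem sum_mul_norm_le {ι : Type*} [Fintype ι] (M N : Matrix ι ι ℂ) (c : ι → ℝ) :
    ∑ t, ∑ s, ‖M s t‖ * c t * ‖N s t‖ ≤ √(∑ t, c t ^ 2 * ∑ s, ‖M s t‖ ^ 2) * ‖N‖ := by
  have h := Real.sum_mul_le_sqrt_mul_sqrt (Finset.univ : Finset (ι × ι))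
    (fun r => ‖M r.2 r.1‖ * c r.1) (fun r => ‖N r.2 r.1‖)
  simp only [Fintype.sum_prod_type] at h
  refine h.trans (le_of_eq ?_)
  congr 1
  · congr 1
    refine Finset.sum_congr rfl fun t _ => ?_
    rw [Finset.mul_sum]
    exact Finset.sum_congr rfl fun s _ => by ring
  · rw [Finset.sum_comm, ← frobenius_sq_eq_sum, Real.sqrt_sq (norm_nonneg _)]

/-- For `E = B D - D A` one has `B s t (c t² - c s²) = E s t c t - c s conj (E t s)`: hermiticity
makes the terms with `A` cancel. Cauchy–Schwarz then gives the bound, with a factor 2 from the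
symmetry in `s` and `t`. -/
theorem sum_norm_sq_mul_abs_sub_le {ι : Type*} [Fintype ι] [DecidableEq ι] {B A : Matrix ι ι ℂ}
    (hB : B.IsHermitian) (hA : A.IsHermitian) {c : ι → ℝ} (hc : ∀ i, 0 < c i) :
    ∑ t, ∑ s, ‖B s t‖ ^ 2 * |c t ^ 2 - c s ^ 2| ≤
      2 * ‖B * Matrix.diagonal (fun i => (c i : ℂ))‖ *
        ‖B * Matrix.diagonal (fun i => (c i : ℂ)) - Matrix.diagonal (fun i => (c i : ℂ)) * A‖ := by
  set D := Matrix.diagonal (fun i => (c i : ℂ)) with hD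
  set E := B * D - D * A with hE
  have hBsymm : ∀ s t, ‖B s t‖ = ‖B t s‖ := fun s t => by
    conv_lhs => rw [← hB.eq, Matrix.conjTranspose_apply, norm_star]
  have hAsymm : ∀ s t, star (A t s) = A s t := fun s t => congrFun (congrFun hA.eq s) t
  have hBs : ∀ s t, star (B t s) = B s t := fun s t => congrFun (congrFun hB.eq s) t
  have hentry : ∀ s t, ‖B s t‖ ^ 2 * |c t ^ 2 - c s ^ 2| ≤
      ‖B s t‖ * c t * ‖E s t‖ + ‖B t s‖ * c s * ‖E t s‖ := by
    intro s t
    have h1 : B s t * ((c t ^ 2 - c s ^ 2 : ℝ) : ℂ) = E s t * c t - c s * star (E t s) := by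
      simp only [hE, hD, Matrix.sub_apply, Matrix.mul_diagonal, Matrix.diagonal_mul, star_sub,
        star_mul', hAsymm, hBs, Complex.star_def, Complex.conj_ofReal]
      push_cast
      ring
    have h2 : ‖B s t‖ * |c t ^ 2 - c s ^ 2| ≤ c t * ‖E s t‖ + c s * ‖E t s‖ := by
      have h3 := norm_sub_le (E s t * c t) (c s * star (E t s))
      rw [← h1, norm_mul, norm_mul, norm_mul, Complex.norm_real, Complex.norm_real,
        Complex.norm_real, norm_star, Real.norm_eq_abs, Real.norm_eq_abs, Real.norm_eq_abs,
        abs_of_pos (hc t), abs_of_pos (hc s), mul_comm (‖E s t‖)] at h3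
      exact h3
    calc ‖B s t‖ ^ 2 * |c t ^ 2 - c s ^ 2| = ‖B s t‖ * (‖B s t‖ * |c t ^ 2 - c s ^ 2|) := by ring
      _ ≤ ‖B s t‖ * (c t * ‖E s t‖ + c s * ‖E t s‖) :=
          mul_le_mul_of_nonneg_left h2 (norm_nonneg _)
      _ = _ := by rw [hBsymm t s]; ring
  refine (Finset.sum_le_sum fun t _ => Finset.sum_le_sum fun s _ => hentry s t).trans ?_
  simp only [Finset.sum_add_distrib]
  rw [Finset.sum_comm (f := fun t s => ‖B t s‖ * c s * ‖E t s‖), ← two_mul, mul_assoc]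
  refine mul_le_mul_of_nonneg_left ((sum_mul_norm_le B E c).trans (le_of_eq ?_)) zero_le_two
  rw [← frobenius_mul_diagonal_sq, Real.sqrt_sq (norm_nonneg _)]

namespace IsNearPerfect

variable {m n : ℕ} {A : Matrix (Fin m) (Fin n) (ZMod 2)} {b : Fin m → ZMod 2}
  {ι : Type*} [Fintype ι] [DecidableEq ι]
  {MA : (i : Fin m) → ({j // j ∈ eqnVars A i} → ZMod 2) → Matrix ι ι ℂ}
  {MB : Fin n → ZMod 2 → Matrix ι ι ℂ} {μ : ℝ}

/-- `X` is Alice's observable for her value of variable `j`. Both `B D` and `D X` have norm at most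
1, and their inner product is at least `1 - 2μ` because the answers disagree with probability at
most `μ`. -/
theorem exists_alice_observable {D : Matrix ι ι ℂ} (h : IsNearPerfect A b D MA MB μ) {i : Fin m}
    {j : Fin n} (hj : j ∈ eqnVars A i) :
    ∃ X : Matrix ι ι ℂ, X.IsHermitian ∧ ‖bobObs MB j * D - D * X‖ ^ 2 ≤ 4 * μ := by
  let P : Matrix ι ι ℂ := ∑ y with y ⟨j, hj⟩ = 0, MA i y
  let Q : Matrix ι ι ℂ := ∑ y with ¬ y ⟨j, hj⟩ = 0, MA i y
  have hP : P.PosSemidef := Matrix.posSemidef_sum _ fun y _ => h.posA i y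
  have hQ : Q.PosSemidef := Matrix.posSemidef_sum _ fun y _ => h.posA i y
  have hPQ : P + Q = 1 := by rw [← h.sumA i, Finset.sum_filter_add_sum_filter_not]
  have hX : (P - Q).IsHermitian := hP.isHermitian.sub hQ.isHermitian
  refine ⟨P - Q, hX, ?_⟩
  have hXs : P - Q = ∑ y, parity (y ⟨j, hj⟩) • MA i y := by
    rw [← Finset.sum_filter_add_sum_filter_not Finset.univ (fun y => y ⟨j, hj⟩ = 0),
      sub_eq_add_neg]
    congr 1
    · refine Finset.sum_congr rfl fun y hy => ?_
      rw [(Finset.mem_filter.1 hy).2, parity_zero, one_smul]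
    · rw [← Finset.sum_neg_distrib]
      refine Finset.sum_congr rfl fun y hy => ?_
      have h1 := parity_eq_neg_of_ne (Finset.mem_filter.1 hy).2
      rw [h1, parity_zero, neg_one_smul]
  have h1 : ‖bobObs MB j * D‖ ≤ 1 := h.norm_eq_one ▸ h.bobObs_contraction j D
  have h2 : ‖D * (P - Q)‖ ≤ 1 := by
    rw [← Matrix.frobenius_norm_conjTranspose, Matrix.conjTranspose_mul, hX.eq, h.isHermitian.eq,
      ← h.norm_eq_one]
    exact frobenius_contraction_mul (hP.one_sub_sq hQ hPQ) D
  have hy : ∀ y, (D * (parity (y ⟨j, hj⟩) • MA i y) * D * bobObs MB j).trace =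
      (D * MA i y * D).trace - 2 * (D * MA i y * D * MB j (y ⟨j, hj⟩ + 1)).trace := by
    intro y
    have h3 := h.add_eq_one j (y ⟨j, hj⟩)
    rw [← eq_sub_iff_add_eq'] at h3
    rw [bobObs_eq MB j (y ⟨j, hj⟩), h3, Matrix.mul_smul, Matrix.mul_smul, Matrix.smul_mul,
      Matrix.smul_mul, smul_smul, parity_mul_self, one_smul, Matrix.mul_sub, Matrix.mul_sub,
      Matrix.mul_one, Matrix.trace_sub, Matrix.trace_sub]
    ring
  have h3 : 1 - 2 * μ ≤ ((bobObs MB j * D)ᴴ * (D * (P - Q))).trace.re := by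
    have h4 : ((bobObs MB j * D)ᴴ * (D * (P - Q))).trace =
        (D * (P - Q) * D * bobObs MB j).trace := by
      rw [Matrix.conjTranspose_mul, h.isHermitian.eq, (h.isHermitian_bobObs j).eq,
        Matrix.trace_mul_comm]
      simp only [Matrix.mul_assoc]
    have h5 : (D * (P - Q) * D * bobObs MB j).trace = (D * D).trace -
        2 * ∑ y, (D * MA i y * D * MB j (y ⟨j, hj⟩ + 1)).trace := by
      rw [hXs, Matrix.mul_sum, Matrix.sum_mul, Matrix.sum_mul, Matrix.trace_sum]
      simp only [hy]
      rw [Finset.sum_sub_distrib, ← Finset.mul_sum, ← Matrix.trace_sum, ← Matrix.sum_mul,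
        ← Matrix.mul_sum, h.sumA, Matrix.mul_one]
    have h6 : (D * D).trace.re = 1 := by
      have := frobenius_sq_eq_trace D
      rw [h.isHermitian.eq, h.norm_eq_one] at this
      linarith
    have h7 := h.sum_loss_le hj
    rw [h4, h5, Complex.sub_re, h6]
    have h8 : (2 * ∑ y, (D * MA i y * D * MB j (y ⟨j, hj⟩ + 1)).trace).re =
        2 * ∑ y, (D * MA i y * D * MB j (y ⟨j, hj⟩ + 1)).trace.re := by
      rw [← Complex.re_sum]; simp
    linarith
  rw [frobenius_sub_sq]
  have h9 := pow_le_pow_left₀ (norm_nonneg _) h1 2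
  have h10 := pow_le_pow_left₀ (norm_nonneg _) h2 2
  linarith

theorem sum_commutator_le {c : ι → ℝ} (hc : ∀ i, 0 < c i)
    (h : IsNearPerfect A b (Matrix.diagonal fun i => (c i : ℂ)) MA MB μ) {i : Fin m} {j : Fin n}
    (hj : j ∈ eqnVars A i) :
    ∑ t, ∑ s, ‖bobObs MB j s t‖ ^ 2 * |c t ^ 2 - c s ^ 2| ≤ 4 * √μ := by
  obtain ⟨X, hX, hE⟩ := h.exists_alice_observable hj
  refine (sum_norm_sq_mul_abs_sub_le (h.isHermitian_bobObs j) hX hc).trans ?_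
  have h1 := h.bobObs_contraction j (Matrix.diagonal fun i => (c i : ℂ))
  rw [h.norm_eq_one] at h1
  have h2 : ‖bobObs MB j * (Matrix.diagonal fun i => (c i : ℂ)) -
      (Matrix.diagonal fun i => (c i : ℂ)) * X‖ ≤ 2 * √μ := by
    have h3 := Real.le_sqrt_of_sq_le hE
    rwa [show (4 : ℝ) * μ = 2 ^ 2 * μ by norm_num, Real.sqrt_mul (by norm_num),
      Real.sqrt_sq zero_le_two] at h3
  calc _ ≤ 2 * 1 * (2 * √μ) := by gcongr
    _ = _ := by ring

end IsNearPerfect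

end Commutator

/-! ### Extracting nearly perfect strategies from quantum value one. -/

section StrategyToApproxRep

variable {m n : ℕ} [NeZero m] [NeZero n] {A : Matrix (Fin m) (Fin n) (ZMod 2)} {b : Fin m → ZMod 2}

theorem exists_isNearPerfect (h : quantumValue (linearSystemGame A b) = 1) {μ : ℝ} (hμ : 0 < μ) :
    ∃ (ι : Type) (_ : Fintype ι) (_ : DecidableEq ι) (c : ι → ℝ)
      (MA : (i : Fin m) → ({j // j ∈ eqnVars A i} → ZMod 2) → Matrix ι ι ℂ)
      (MB : Fin n → ZMod 2 → Matrix ι ι ℂ), (∀ i, 0 < c i) ∧ ∑ i, c i ^ 2 = 1 ∧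
      IsNearPerfect A b (Matrix.diagonal fun i => (c i : ℂ)) MA MB μ := by
  classical
  have hmn : (0 : ℝ) < (m : ℝ) * n := by
    have h1 : (m : ℝ) ≠ 0 := Nat.cast_ne_zero.2 (NeZero.ne m)
    have h2 : (n : ℝ) ≠ 0 := Nat.cast_ne_zero.2 (NeZero.ne n)
    positivity
  -- A real supremum over an empty family is 0 by default, which contradicts the value being 1.
  have hne : Nonempty (FinDimStrategy (linearSystemGame A b)) := by
    by_contra h0
    rw [not_nonempty_iff] at h0
    rw [quantumValue, Real.iSup_of_isEmpty] at h
    exact zero_ne_one h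
  -- Every question pair has weight `1 / (m n)`, so a total loss below `μ / (m n)` bounds the loss
  -- on each pair by `μ`.
  obtain ⟨S, hS⟩ := exists_lt_of_lt_ciSup (f := fun S : FinDimStrategy (linearSystemGame A b) =>
    S.winProb) (b := 1 - μ / (m * n)) (by
      change _ < quantumValue _
      rw [h]
      have : 0 < μ / (m * n) := by positivity
      linarith)
  obtain ⟨ι, i1, i2, c, MA, MB, hc, hc1, hA, hA1, hB, hB1, hp⟩ := exists_matrices_answerProb S
  refine ⟨ι, i1, i2, c, MA, MB, hc, hc1, ?_, ?_, hA, hA1, hB, hB1, fun i j s hs => ?_⟩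
  · exact diagonal_ofReal_conjTranspose c
  · have h1 := frobenius_mul_diagonal_sq (1 : Matrix ι ι ℂ) c
    have h2 : ∀ t, ∑ s, ‖(1 : Matrix ι ι ℂ) s t‖ ^ 2 = 1 := fun t => by
      simp [Matrix.one_apply, apply_ite]
    simp only [h2, mul_one, hc1, Matrix.one_mul] at h1
    exact (sq_eq_sq₀ (norm_nonneg _) zero_le_one).1 (by rw [h1, one_pow])
  · simp only [winProb_linearSystemGame, ← Finset.mul_sum] at hS
    have hnn : ∀ i j y z, 0 ≤ (if IsWinning A b i j y z then 0 else 1) * answerProb S i j y z :=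
      fun i j y z => mul_nonneg (by split_ifs <;> simp) (answerProb_nonneg S i j y z)
    have h1 : ∑ i, ∑ j, ∑ y, ∑ z, (if IsWinning A b i j y z then 0 else 1) *
        answerProb S i j y z ≤ μ := by
      have h2 := sub_lt_sub_iff_left 1 |>.1 hS
      rw [one_div, inv_mul_eq_div, div_lt_div_iff_of_pos_right hmn] at h2
      exact h2.le
    have h3 : ∑ y, ∑ z, (if IsWinning A b i j y z then 0 else 1) * answerProb S i j y z ≤ μ := by
      refine le_trans ?_ h1
      refine le_trans ?_ (Finset.single_le_sum (fun i _ => Finset.sum_nonneg fun j _ =>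
        Finset.sum_nonneg fun y _ => Finset.sum_nonneg fun z _ => hnn i j y z) (Finset.mem_univ i))
      exact Finset.single_le_sum (f := fun j => ∑ y, ∑ z, (if IsWinning A b i j y z then 0 else 1) *
        answerProb S i j y z) (fun j _ =>
        Finset.sum_nonneg fun y _ => Finset.sum_nonneg fun z _ => hnn i j y z) (Finset.mem_univ j)
    refine le_trans ?_ h3
    rw [← Fintype.sum_prod_type' (f := fun y z => (if IsWinning A b i j y z then 0 else 1) *
      answerProb S i j y z)]
    refine le_trans (le_of_eq ?_) (Finset.sum_le_sum_of_subset_of_nonneg (Finset.subset_univ s)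
      fun r _ _ => hnn i j r.1 r.2)
    refine Finset.sum_congr rfl fun r hr => ?_
    rw [if_neg (hs r hr), one_mul, hp]

end StrategyToApproxRep

/-! ### Relation words and the approximate representation. -/

section Words

open Filter Topology SolutionGroup

variable {m n : ℕ} (A : Matrix (Fin m) (Fin n) (ZMod 2)) (b : Fin m → ZMod 2)

/-- The words in the `x_j` occurring in the relations of the solution group: the product of an
equation, and the commutators of variables of a common equation. -/
def relationWord : Fin m ⊕ Fin m × Fin n × Fin n → List (Fin n)
  | .inl i => List.ofFn (eqnEnum A i)
  -- For involutions `[j, k, j, k]` is the commutator; the empty word makes the relation trivial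
  -- when the variables do not share equation `i`.
  | .inr (i, j, k) => if j ∈ eqnVars A i ∧ k ∈ eqnVars A i then [j, k, j, k] else []

/-- The scalar to which `relationWord` is equal for `J = -1`. -/
noncomputable def relationValue : Fin m ⊕ Fin m × Fin n × Fin n → ℂ
  | .inl i => parity (b i)
  | .inr _ => 1

theorem length_relationWord_le (r : Fin m ⊕ Fin m × Fin n × Fin n) :
    (relationWord A r).length ≤ n + 4 := by
  rcases r with i | ⟨i, j, k⟩
  · have := Finset.card_le_univ (eqnVars A i)
    simp only [Fintype.card_fin] at this
    simp only [relationWord, List.length_ofFn]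
    omega
  · simp only [relationWord]; split_ifs <;> simp

theorem mem_eqnVars_of_mem_relationWord {r : Fin m ⊕ Fin m × Fin n × Fin n} {j : Fin n}
    (hj : j ∈ relationWord A r) : ∃ i, j ∈ eqnVars A i := by
  rcases r with i | ⟨i, k, l⟩
  · obtain ⟨a, rfl⟩ := List.mem_ofFn.1 hj
    exact ⟨i, eqnEnum_mem A i a⟩
  · simp only [relationWord] at hj
    split_ifs at hj with h
    · refine ⟨i, ?_⟩
      simp only [List.mem_cons, List.not_mem_nil, or_false] at hj
      rcases hj with rfl | rfl | rfl | rfl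
      exacts [h.1, h.2, h.1, h.2]
    · simp at hj

variable {A b}

theorem norm_relationWord_sub_le [NeZero n] {ι : Type*} [Fintype ι] [DecidableEq ι]
    {D : Matrix ι ι ℂ} {MA : (i : Fin m) → ({j // j ∈ eqnVars A i} → ZMod 2) → Matrix ι ι ℂ}
    {MB : Fin n → ZMod 2 → Matrix ι ι ℂ} {μ : ℝ} (h : IsNearPerfect A b D MA MB μ) (hμ : 0 ≤ μ)
    (r : Fin m ⊕ Fin m × Fin n × Fin n) :
    ‖(((relationWord A r).map (bobObs MB)).prod - relationValue b r • 1) * D‖ ^ 2 ≤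
      (8 * n * ((n : ℝ) + 4) ^ 2 + 8) * μ := by
  have key : ∀ (i : Fin m) (L : List {j // j ∈ eqnVars A i}) (s : ℂ), L.length ≤ n + 4 →
      ‖s‖ = 1 → (∀ y : {j // j ∈ eqnVars A i} → ZMod 2, ∑ k, y k = b i →
        (L.map fun j => parity (y j)).prod = s) →
      ‖((L.map fun j => bobObs MB j.1).prod - s • 1) * D‖ ^ 2 ≤
      (8 * n * ((n : ℝ) + 4) ^ 2 + 8) * μ := by
    intro i L s hlen hs hL
    refine (h.norm_word_sub_le L hs hL).trans (mul_le_mul_of_nonneg_right ?_ hμ)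
    have : (L.length : ℝ) ≤ n + 4 := by exact_mod_cast hlen
    gcongr
  rcases r with i | ⟨i, j, k⟩
  · have h1 := key i (List.ofFn ((eqnVars A i).orderIsoOfFin rfl)) (parity (b i))
      (by simpa [relationWord] using length_relationWord_le A (.inl i))
      (IsNearPerfect.norm_parity _) (by
        intro y hy
        rw [List.map_ofFn, List.prod_ofFn, ← hy, parity_sum]
        exact ((eqnVars A i).orderIsoOfFin rfl).toEquiv.prod_comp fun k => parity (y k))
    rw [List.map_ofFn] at h1
    rw [relationWord, relationValue, List.map_ofFn]
    exact h1
  · simp only [relationWord, relationValue]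
    split_ifs with hjk
    · refine key i [⟨j, hjk.1⟩, ⟨k, hjk.2⟩, ⟨j, hjk.1⟩, ⟨k, hjk.2⟩] 1 (by simp) (by simp) ?_
      intro y _
      simp only [List.map_cons, List.map_nil, List.prod_cons, List.prod_nil, mul_one]
      linear_combination parity (y ⟨k, hjk.2⟩) ^ 2 * parity_mul_self (y ⟨j, hjk.1⟩) +
        parity_mul_self (y ⟨k, hjk.2⟩)
    · simp only [List.map_nil, List.prod_nil, one_smul, sub_self, Matrix.zero_mul, norm_zero,
        zero_pow two_ne_zero]
      positivity

theorem exists_involutions_of_quantumValue_eq_one [NeZero m] [NeZero n]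
    (h : quantumValue (linearSystemGame A b) = 1) {ε : ℝ} (hε : 0 < ε) :
    ∃ (d : ℕ) (U : Fin n → Matrix (Fin d) (Fin d) ℂ), 0 < d ∧ (∀ j, (U j).IsHermitian) ∧
      (∀ j, U j * U j = 1) ∧ ∀ r, normalizedFrobenius
        (((relationWord A r).map U).prod - relationValue b r • 1) ≤ ε := by
  -- Only variables occurring in some equation have controlled observables. The others still receive
  -- involutions but appear in no relation word.
  let T : Finset (Fin n) := Finset.univ.biUnion (eqnVars A)
  let C : ℝ := Fintype.card (Fin m ⊕ Fin m × Fin n × Fin n)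
  let K : ℝ := 8 * n * ((n : ℝ) + 4) ^ 2 + 8
  let θ : ℝ → ℝ := fun μ => T.card * (2 * (4 * √μ) + 4 * μ) + C * (K * μ)
  have hθ : Tendsto θ (𝓝[>] 0) (𝓝 0) := by
    have hcont : Continuous θ := by fun_prop
    have := hcont.tendsto 0
    simp only [θ, Real.sqrt_zero, mul_zero, add_zero] at this
    exact this.mono_left nhdsWithin_le_nhds
  -- A word has at most `n + 4` letters, each costing one intertwining error; the relation error on
  -- `V` is one more, hence `n + 5`.
  have hε' : 0 < (ε / ((n : ℝ) + 5)) ^ 2 := by positivity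
  obtain ⟨μ, hμθ, hμ⟩ := ((hθ.eventually (gt_mem_nhds hε')).and self_mem_nhdsWithin).exists
  replace hμ : 0 < μ := hμ
  obtain ⟨ι, _, _, c, MA, MB, hc, hc1, hP⟩ := exists_isNearPerfect h hμ
  obtain ⟨d, V, U, hd, hV, hUh, hUU, hUB, hX⟩ := exists_isometry_involutions c hc hc1 T (bobObs MB)
    hP.isHermitian_bobObs hP.posSemidef_one_sub_bobObs
    (fun r => ((relationWord A r).map (bobObs MB)).prod - relationValue b r • 1) (θ μ) (by
      refine add_le_add ?_ ?_
      · rw [← nsmul_eq_mul]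
        refine Finset.sum_le_card_nsmul _ _ _ fun j hj => ?_
        obtain ⟨i, -, hi⟩ := Finset.mem_biUnion.1 hj
        have h1 := hP.sum_commutator_le hc hi
        have h2 := hP.one_sub_norm_sq_bobObs_le hi
        linarith
      · rw [← nsmul_eq_mul]
        exact Finset.sum_le_card_nsmul _ _ _ fun r _ => norm_relationWord_sub_le hP hμ.le r)
  refine ⟨d, U, hd, hUh, hUU, fun r => ?_⟩
  have hd' : (0 : ℝ) < √d := Real.sqrt_pos.2 (by exact_mod_cast hd)
  have hη : √(θ μ * d) ≤ ε / (n + 5) * √d := by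
    rw [Real.sqrt_mul' _ (Nat.cast_nonneg d)]
    gcongr
    exact Real.sqrt_le_iff.2 ⟨by positivity, hμθ.le⟩
  have hUn : ∀ j (X : Matrix ι (Fin d) ℂ), ‖X * U j‖ = ‖X‖ := fun j X =>
    frobenius_mul_coisometry (by rw [(hUh j).eq, hUU]) X
  have h1 := frobenius_list_prod_intertwining (relationWord A r) V
    (fun j _ X => hP.bobObs_contraction j X) (fun j _ X => hUn j X)
  have h2 : ((relationWord A r).map fun j => ‖bobObs MB j * V - V * U j‖).sum ≤
      (n + 4) * √(θ μ * d) := by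
    have h3 := List.sum_le_card_nsmul ((relationWord A r).map fun j =>
      ‖bobObs MB j * V - V * U j‖) (√(θ μ * d)) (by
        intro x hx
        obtain ⟨j, hj, rfl⟩ := List.mem_map.1 hx
        obtain ⟨i, hi⟩ := mem_eqnVars_of_mem_relationWord A hj
        exact Real.le_sqrt_of_sq_le (hUB j (Finset.mem_biUnion.2 ⟨i, Finset.mem_univ _, hi⟩)))
    rw [List.length_map, nsmul_eq_mul] at h3
    refine h3.trans (mul_le_mul_of_nonneg_right ?_ (Real.sqrt_nonneg _))
    exact_mod_cast length_relationWord_le A r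
  have h4 := Real.le_sqrt_of_sq_le (hX r)
  rw [normalizedFrobenius_eq, div_le_iff₀ hd', ← frobenius_isometry_mul hV]
  have e : V * (((relationWord A r).map U).prod - relationValue b r • 1) =
      (((relationWord A r).map (bobObs MB)).prod - relationValue b r • 1) * V -
      (((relationWord A r).map (bobObs MB)).prod * V - V * ((relationWord A r).map U).prod) := by
    rw [Matrix.sub_mul, Matrix.mul_sub, Matrix.smul_mul, Matrix.mul_smul, Matrix.one_mul,
      Matrix.mul_one]
    abel
  rw [e]
  calc _ ≤ √(θ μ * d) + (n + 4) * √(θ μ * d) :=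
        (norm_sub_le _ _).trans (add_le_add h4 (h1.trans h2))
    _ = (n + 5) * √(θ μ * d) := by ring
    _ ≤ (n + 5) * (ε / (n + 5) * √d) := by gcongr
    _ = ε * √d := by field_simp

theorem normalizedFrobenius_mul_inv_sub_one {d : ℕ} (Y p : Matrix.unitaryGroup (Fin d) ℂ) :
    normalizedFrobenius (((Y * p⁻¹ : Matrix.unitaryGroup (Fin d) ℂ) :
      Matrix (Fin d) (Fin d) ℂ) - 1) =
      normalizedFrobenius ((Y : Matrix (Fin d) (Fin d) ℂ) - (p : Matrix (Fin d) (Fin d) ℂ)) := by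
  rw [← normalizedFrobenius_mul_unitary p, Matrix.sub_mul, Matrix.one_mul]
  congr 2
  exact congrArg Subtype.val (inv_mul_cancel_right Y p)

theorem nontrivialInApproxReps_of_quantumValue_eq_one [NeZero m] [NeZero n]
    (h : quantumValue (linearSystemGame A b) = 1) :
    NontrivialInApproxReps (relators A b) (genJ A b) := by
  -- With `J ↦ -1` the distance to 1 is exactly 2, so `δ = 1` is enough. The relators `J_sq`,
  -- `x_comm_J` and `x_sq` hold exactly; only equations and commutators of variables need estimates.
  refine ⟨J, rfl, 1, one_pos, fun ε hε => ?_⟩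
  obtain ⟨d, U, hd, hUh, hUU, hU⟩ := exists_involutions_of_quantumValue_eq_one h hε
  let u : Fin n → Matrix.unitaryGroup (Fin d) ℂ := fun j =>
    ⟨U j, Matrix.mem_unitaryGroup_iff.2 ((congrArg (U j * ·) (hUh j).eq).trans (hUU j))⟩
  let g : Matrix.unitaryGroup (Fin d) ℂ := ⟨-1, Matrix.mem_unitaryGroup_iff.2 (by simp)⟩
  let φ : FreeGroup (Option (Fin n)) →* Matrix.unitaryGroup (Fin d) ℂ :=
    FreeGroup.lift fun o => o.elim g u
  have hφx : ∀ j, φ (SolutionGroup.x j) = u j := fun j => FreeGroup.lift_apply_of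
  have hφJ : φ J = g := FreeGroup.lift_apply_of
  have huu : ∀ j, u j * u j = 1 := fun j => Subtype.ext (hUU j)
  have hgg : g * g = 1 := Subtype.ext (by simp [g])
  have hgu : ∀ j, u j * g = g * u j := fun j => Subtype.ext (by simp [g])
  have hword : ∀ L : List (Fin n),
      (((L.map u).prod : Matrix.unitaryGroup (Fin d) ℂ) : Matrix (Fin d) (Fin d) ℂ) =
        (L.map U).prod := fun L => by
    induction L with
    | nil => rfl
    | cons a L ih => rw [List.map_cons, List.prod_cons, List.map_cons, List.prod_cons, ← ih]; rfl
  have h0 : ∀ w : FreeGroup (Option (Fin n)), φ w = 1 →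
      normalizedFrobenius ((φ w : Matrix (Fin d) (Fin d) ℂ) - 1) ≤ ε := by
    intro w hw
    rw [hw]
    simpa [normalizedFrobenius_eq] using hε.le
  refine ⟨d, hd, φ, ?_, ?_⟩
  · intro r hr
    change IsRelator A b r at hr
    cases hr with
    | J_sq => exact h0 _ (by rw [map_pow, hφJ, sq, hgg])
    | x_comm_J j =>
      refine h0 _ ?_
      rw [map_mul, map_mul, map_mul, map_inv, map_inv, hφJ, hφx, hgu, mul_inv_cancel_right,
        mul_inv_cancel]
    | x_sq j => exact h0 _ (by rw [map_pow, hφx, sq, huu])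
    | eqn i =>
      have h1 := hU (.inl i)
      rw [map_mul, map_inv, normalizedFrobenius_mul_inv_sub_one, map_pow, hφJ, eqnProd_eq_ofFn,
        map_list_prod, List.map_ofFn]
      have h2 : (List.ofFn (φ ∘ fun a => SolutionGroup.x (eqnEnum A i a))) =
          (relationWord A (.inl i)).map u := by
        rw [relationWord, List.map_ofFn]
        congr 1
        ext1 a
        exact hφx _
      have h3 : ((g ^ (b i).val : Matrix.unitaryGroup (Fin d) ℂ) : Matrix (Fin d) (Fin d) ℂ) =
          relationValue (n := n) b (.inl i) • 1 := by
        have h4 : ∀ k : ℕ, ((g ^ k : Matrix.unitaryGroup (Fin d) ℂ) : Matrix (Fin d) (Fin d) ℂ) =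
            ((-1 : ℂ) ^ k) • 1 := fun k => by
          induction k with
          | zero => rw [pow_zero, pow_zero, one_smul]; rfl
          | succ k ih =>
            rw [pow_succ, pow_succ, mul_neg_one, neg_smul, ← ih]
            change _ * (-1 : Matrix (Fin d) (Fin d) ℂ) = _
            rw [mul_neg_one]
        exact h4 _
      rw [h2, hword, h3]
      exact h1
    | x_comm_x i j k hj hk =>
      have h1 := hU (.inr (i, j, k))
      have hinv : ∀ j, (u j)⁻¹ = u j := fun j => inv_eq_of_mul_eq_one_left (huu j)
      have h2 : φ (SolutionGroup.x j * SolutionGroup.x k * (SolutionGroup.x j)⁻¹ *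
          (SolutionGroup.x k)⁻¹) = ((relationWord A (.inr (i, j, k))).map u).prod := by
        rw [map_mul, map_mul, map_mul, map_inv, map_inv, hφx, hφx, hinv, hinv, relationWord,
          if_pos ⟨hj, hk⟩]
        simp [mul_assoc]
      rw [h2, hword]
      simpa only [relationValue, one_smul] using h1
  · rw [hφJ]
    have h1 : (g : Matrix (Fin d) (Fin d) ℂ) - 1 = (-2 : ℂ) • 1 := by
      change (-1 : Matrix (Fin d) (Fin d) ℂ) - 1 = _
      module
    have hd' : (0 : ℝ) < √d := Real.sqrt_pos.2 (by exact_mod_cast hd)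
    have h2 : ‖(1 : Matrix (Fin d) (Fin d) ℂ)‖ = √d := by
      have := frobenius_sq_eq_trace (1 : Matrix (Fin d) (Fin d) ℂ)
      rw [← Real.sqrt_sq (norm_nonneg (1 : Matrix (Fin d) (Fin d) ℂ)), this]
      simp
    rw [h1, normalizedFrobenius_smul, normalizedFrobenius_eq, h2, div_self hd'.ne']
    norm_num

end Words

theorem mainTheorem7 {m n : ℕ} [NeZero m] [NeZero n]
    (A : Matrix (Fin m) (Fin n) (ZMod 2)) (b : Fin m → ZMod 2) :
    quantumValue (linearSystemGame A b) = 1 ↔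
      NontrivialInApproxReps (SolutionGroup.relators A b) (SolutionGroup.genJ A b) :=
  ⟨nontrivialInApproxReps_of_quantumValue_eq_one,
    quantumValue_eq_one_of_nontrivialInApproxReps A b⟩
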